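/- Let $I\subseteq\mathbb R$ be an interval that is unbounded below (left endpoint $a=-\infty$), let $b=\sup I$, and let $k,n$ be integers with $1\le k\le n+1$. Definitions (unit gauges). Let $\mathcal L^0$ be the set of all Borel functions $f\colon I\to\mathbb R$, with $f^{(0)}:=f$. Recursively, $\mathcal L^{j+1}$ is the set of all $f\in\mathcal L^{j}$ for which there is a function $f^{(j+1)}\colon I\to\mathbb R$, right-continuous on $I\setminus\{b\}$ and left-continuous at $b$ if $b\in I$, such that $f^{(j)}(x)=f^{(j)}(z)+\int_z^x f^{(j+1)}(u)\,du$ for all $x,z\in I$ (such an $f^{(j+1)}$ is unique). Let $\mathcal F_+^{k:n}$ be the set of all $f\in\mathcal L^n$ such that $f^{(j)}$ is nondecreasing for each $j\in\{k-1,\dots,n\}$. For $t\in I$ and $x\in\mathbb R$ let $(x-t)_+^n:=(x-t)^n$ if $x\ge t$ and $(x-t)_+^n:=0$ if $x<t$; in particular $(x-t)_+^0=\mathbf 1\{x\ge t\}$. Let $\mathcal G$ be any set of functions with $\mathcal G\subseteq\mathcal F_+^{k:n}$ that contains all polynomials (restricted to $I$) of degree $\le n$ belonging to $\mathcal F_+^{k:n}$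 and all functions $I\ni x\mapsto (x-t)_+^n/n!$ with $t\in I$. For a nonnegative (not necessarily finite) Borel measure $\nu$ on $I$ and a Borel function $f\colon I\to\mathbb R$, put $\nu(f):=\int_I f_+\,d\nu-\int_I f_-\,d\nu\in[-\infty,\infty]$ if at least one of the two integrals is finite; every assertion about $\nu(f)$, or about an integral written $\int_I f\,d\nu$, includes the assertion that it exists in this sense. Let $\mathcal N_+(\mathcal G)$ be the set of all nonnegative Borel measures $\nu$ on $I$ with $\nu(f)>-\infty$ for all $f\in\mathcal G$, and let $$\hat{\mathcal G}:=\{(\nu_1,\nu_2)\in\mathcal N_+(\mathcal G)\times\mathcal N_+(\mathcal G)\colon \nu_1(f)\ge\nu_2(f)\text{ for all }f\in\mathcal G\}.$$ Statement. Take any $(\nu_1,\nu_2)\in\mathcal N_+(\mathcal G)\times\mathcal N_+(\mathcal G)$ and any real $s$ and $z$. Then $(\nu_1,\nu_2)\in\hat{\mathcal G}$ if and only if all of the following conditions hold: (i) $\int_I(x-s)^i\,\nu_1(dx)=\int_I(x-s)^i\,\nu_2(dx)\in\mathbb R$ for all $i\in\{0,\dots,k-1\}$ (with $0^0:=1$);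 (ii) if $k\le n$, then $\int_I(x-z)^k\,\nu_1(dx)\ge\int_I(x-z)^k\,\nu_2(dx)$; (iii) $\int_I(x-t)_+^n\,\nu_1(dx)\ge\int_I(x-t)_+^n\,\nu_2(dx)$ for all $t\in I$. -/

import Mathlib

open MeasureTheory Set

namespace GMM

variable {I : Set ℝ}

/-- Extension by zero to the whole line of a function given on the interval `I`. -/
noncomputable def zeroExt (g : I → ℝ) : ℝ → ℝ :=
  Function.extend Subtype.val g 0

/-- The class `LD(I)`: functions on `I` that are right-continuous on `I ∖ {b}`, and left-continuous
at the right endpoint `b` of `I` when `b ∈ I` (i.e. at the maximum of `I`, when there is one). -/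
def LD (I : Set ℝ) : Set (I → ℝ) :=
  {g | ∀ x : I, (¬ IsMax x → ContinuousWithinAt g (Ici x) x) ∧
    (IsMax x → ContinuousWithinAt g (Iic x) x)}

/-- `d = D_v f`: the function `d` is Borel, `d / v ∈ LD(I)`, `d` is integrable over every interval
`[z, x]` with endpoints in `I`, and `f x = f z + ∫_z^x d` for all `x`, `z` in `I`. For a Borel
`v > 0` there is at most one such `d`; the domain of the operator `D_v` consists of the Borel
functions `f` for which it exists. -/
def IsGaugedDeriv (v f d : I → ℝ) : Prop :=
  Measurable f ∧ Measurable d ∧ (fun x => d x / v x) ∈ LD I ∧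
    ∀ x z : I, IntervalIntegrable (zeroExt d) volume z x ∧
      f x = f z + ∫ u in (z : ℝ)..x, zeroExt d u

/-- `IsGenDeriv w j f g` says that `f` is in the domain `L^j` of the operator `E^j` and that
`g = f^{(j)} = E^j f`, where `E^0 f = f / w_0` and `E^{j+1} f = D_{w_{j+1}} (E^j f) / w_{j+1}`. -/
def IsGenDeriv (w : ℕ → I → ℝ) : ℕ → (I → ℝ) → (I → ℝ) → Prop
  | 0, f, g => Measurable f ∧ ∀ x, g x = f x / w 0 x
  | j + 1, f, g => ∃ h d : I → ℝ, IsGenDeriv w j f h ∧ IsGaugedDeriv (w (j + 1)) h d ∧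
      ∀ x, g x = d x / w (j + 1) x

/-- The class `L^j` of the functions that have a generalized derivative of order `j`. -/
def genDiff (w : ℕ → I → ℝ) (j : ℕ) : Set (I → ℝ) :=
  {f | ∃ g, IsGenDeriv w j f g}

/-- The cone `F_+^{k:n}` (for `1 ≤ k ≤ n + 1`): all `f ∈ L^n` whose generalized derivative `f^{(j)}`
is nondecreasing for each `j ∈ {k-1, …, n}`. -/
def coneF (w : ℕ → I → ℝ) (k n : ℕ) : Set (I → ℝ) :=
  {f | f ∈ genDiff w n ∧
    ∀ j : ℕ, k ≤ j + 1 → j ≤ n → ∃ g, IsGenDeriv w j f g ∧ Monotone g}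

/-- The set `P^{≤m}` of the `w`-polynomials of degree at most `m`: `p ∈ L^{m+1}`, `p^{(m+1)} = 0`. -/
def polyLE (w : ℕ → I → ℝ) (m : ℕ) : Set (I → ℝ) :=
  {p | IsGenDeriv w (m + 1) p 0}

/-- `P_+^{k:n} = P^{≤n} ∩ F_+^{k:n}`. -/
def polyCone (w : ℕ → I → ℝ) (k n : ℕ) : Set (I → ℝ) :=
  polyLE w n ∩ coneF w k n

/-- The chain of `w`-polynomials vanishing at `t ∈ I`: `vanPoly w t d j` is `p_{t;j,m}` with
`m = j + d`, so that `p_{t;m,m} = w_m` and `p_{t;j,m}(x) = w_j(x) ∫_t^x p_{t;j+1,m}(u) du` for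
`j < m`. -/
noncomputable def vanPoly (w : ℕ → I → ℝ) (t : I) : ℕ → ℕ → I → ℝ
  | 0, j => w j
  | d + 1, j => fun x => w j x * ∫ u in (t : ℝ)..x, zeroExt (vanPoly w t d (j + 1)) u

/-- The positive part `p_{t;0,n}^+(x) = p_{t;0,n}(x) 1{x ≥ t}`. -/
noncomputable def vanPolyPos (w : ℕ → I → ℝ) (n : ℕ) (t : I) : I → ℝ :=
  fun x => if (t : ℝ) ≤ x then vanPoly w t n 0 x else 0

/-- The set `P^+_{0:n} = {p_{t;0,n}^+ : t ∈ I}`. -/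
def polyPos (w : ℕ → I → ℝ) (n : ℕ) : Set (I → ℝ) :=
  {f | ∃ t : I, f = vanPolyPos w n t}

/-- The integral `ν(f)` exists in the extended sense: `ν(f_+) < ∞` or `ν(f_-) < ∞`. -/
def IntExists (ν : Measure I) (f : I → ℝ) : Prop :=
  ∫⁻ x, ENNReal.ofReal (f x) ∂ν < ⊤ ∨ ∫⁻ x, ENNReal.ofReal (-f x) ∂ν < ⊤

/-- The extended integral `ν(f) = ν(f_+) - ν(f_-) ∈ [-∞, ∞]`, to be used only together with
`IntExists ν f`. -/
noncomputable def extInt (ν : Measure I) (f : I → ℝ) : EReal :=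
  ((∫⁻ x, ENNReal.ofReal (f x) ∂ν : ENNReal) : EReal) -
    ((∫⁻ x, ENNReal.ofReal (-f x) ∂ν : ENNReal) : EReal)

/-- `ν₁(f) ≥ ν₂(f)`, both integrals existing in the extended sense. -/
def IntGE (ν₁ ν₂ : Measure I) (f : I → ℝ) : Prop :=
  IntExists ν₁ f ∧ IntExists ν₂ f ∧ extInt ν₂ f ≤ extInt ν₁ f

/-- `ν₁(f) = ν₂(f) ∈ ℝ`, both integrals existing in the extended sense. -/
def IntEqReal (ν₁ ν₂ : Measure I) (f : I → ℝ) : Prop :=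
  IntExists ν₁ f ∧ IntExists ν₂ f ∧ ∃ r : ℝ, extInt ν₁ f = r ∧ extInt ν₂ f = r

/-- The admissible set `N_+(G)` of the nonnegative Borel measures `ν` on `I`, not necessarily finite,
such that `ν(f)` exists and `ν(f) > -∞` for all `f ∈ G`. -/
def admissible (G : Set (I → ℝ)) : Set (Measure I) :=
  {ν | ∀ f ∈ G, IntExists ν f ∧ ⊥ < extInt ν f}

/-- The dual cone of `G`: the pairs of admissible measures with `ν₁(f) ≥ ν₂(f)` for all `f ∈ G`. -/
def dualCone (G : Set (I → ℝ)) : Set (Measure I × Measure I) :=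
  {ν | ν.1 ∈ admissible G ∧ ν.2 ∈ admissible G ∧ ∀ f ∈ G, IntGE ν.1 ν.2 f}

/-- The truncated power `x ↦ (x - t)_+^n`, with `(x - t)_+^0` read as `1{x ≥ t}`. -/
noncomputable def truncPow (n : ℕ) (t x : ℝ) : ℝ :=
  if t ≤ x then (x - t) ^ n else 0

end GMM

/-! Necessity: the polynomials of degree below `k` with both signs, `(x - z)^k` when `k ≤ n`, and
the functions `(x - t)_+^n / n!` all lie in `G`.

Sufficiency: let `f` be in the cone. Each of `f^(n), ..., f^(k-1)` is nondecreasing and each is an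
integral of the one before. On an interval unbounded below this forces `f^(j) ≥ 0` for `j ≥ k`, and
`f^(j) → 0` at `-∞` for `k < j < n + 1`. Slice `f^(n)` into its superlevel sets `{f^(n) ≥ y}` with
left endpoints `τ_y` and integrate from `-∞`: with `q = n + 1 - k`, the increments of `f^(k-1)` are
those of `c x + ∫ (x - τ_y)_+^q / q! dy`, where `c ≥ 0` is the limit of `f^(k)` at `-∞` (`c = 0` if
`k = n + 1`); see `IntegralChain.exists_sub_eq_lintegral`. Integrating `k - 1` more times from a
base point `x₀`, `f` becomes a polynomial of degree below `k`, plus `c (x - x₀)^k / k!`, plus a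
mixture over `y` of the Taylor remainders of degree `k - 1` at `x₀` of `(x - τ_y)_+^n / n!`
(`ofReal_taylorRem`). Condition (i) handles the polynomials, (ii) the power, and (i) with (iii) each
remainder (`crossLE_of_integralChain`).

Remainders are used because the mixture of the truncated powers themselves may diverge. They have
the sign of `(x - x₀)^k`, so Tonelli applies to positive and negative parts separately, and the
negative part of the mixture is controlled by that of `f`. -/

namespace GMM

/-! ### Truncated powers attached to the superlevel sets of a nondecreasing function. -/

section LevelPow

/-- Tonelli. Working in `ENNReal` avoids any integrability assumption in the level variable `y`. -/
theorem ofReal_setIntegral_eq_lintegral {μ : Measure ℝ} [SFinite μ] {S : Set ℝ}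
    (hS : MeasurableSet S) {A : ℝ → ℝ} {V : ℝ → ℝ → ℝ}
    (hA : IntegrableOn A S) (hA0 : ∀ u ∈ S, 0 ≤ A u)
    (hVm : Measurable (Function.uncurry V))
    (hV : ∀ᵐ y ∂μ, IntegrableOn (fun u => V u y) S ∧ ∀ u ∈ S, 0 ≤ V u y)
    (h : ∀ u ∈ S, ENNReal.ofReal (A u) = ∫⁻ y, ENNReal.ofReal (V u y) ∂μ) :
    ENNReal.ofReal (∫ u in S, A u) = ∫⁻ y, ENNReal.ofReal (∫ u in S, V u y) ∂μ := by
  rw [ofReal_integral_eq_lintegral_ofReal hA ((ae_restrict_iff' hS).2 (ae_of_all _ hA0)),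
    setLIntegral_congr_fun hS h, lintegral_lintegral_swap]
  · refine lintegral_congr_ae ?_
    filter_upwards [hV] with y hy
    rw [ofReal_integral_eq_lintegral_ofReal hy.1 ((ae_restrict_iff' hS).2 (ae_of_all _ hy.2))]
  · exact (hVm.ennreal_ofReal).aemeasurable

/-- The superlevel set `{u ∈ I | y ≤ h u}`. -/
def upperLevel (I : Set ℝ) (h : ℝ → ℝ) (y : ℝ) : Set ℝ := {u | u ∈ I ∧ y ≤ h u}

open Classical in
/-- For nondecreasing `h` and `τ = inf {h ≥ y}`, this is `(x - τ)^j / j!` on `{h ≥ y}` and `0`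
elsewhere. The length of `{h ≥ y} ∩ (-∞, x]` stands for `x - τ`, which makes joint measurability
in `(x, y)` immediate. -/
noncomputable def levelPow (I : Set ℝ) (h : ℝ → ℝ) (j : ℕ) (x y : ℝ) : ℝ :=
  if x ∈ upperLevel I h y then
    (volume (upperLevel I h y ∩ Iic x)).toReal ^ j / (j.factorial : ℝ) else 0

/-- The levels `y` for which `{h ≥ y}` is not all of `I`. -/
def properLevels (I : Set ℝ) (h : ℝ → ℝ) : Set ℝ := {y | ∃ x ∈ I, h x < y}

variable {I : Set ℝ} {h : ℝ → ℝ}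

theorem measurableSet_properLevels : MeasurableSet (properLevels I h) := by
  have : OrdConnected (properLevels I h) := by
    refine ⟨fun a ha b _ c hc => ?_⟩
    obtain ⟨x, hx, hxa⟩ := ha
    exact ⟨x, hx, hxa.trans_le hc.1⟩
  exact this.measurableSet

theorem measurable_levelPow (hI : MeasurableSet I) (hh : Measurable h) (j : ℕ) :
    Measurable (Function.uncurry (levelPow I h j)) := by
  classical
  have h1 : MeasurableSet {p : ℝ × ℝ | p.1 ∈ upperLevel I h p.2} :=
    (measurable_fst hI).inter (measurableSet_le measurable_snd (hh.comp measurable_fst))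
  have h2 : MeasurableSet {q : (ℝ × ℝ) × ℝ | q.2 ∈ upperLevel I h q.1.2 ∩ Iic q.1.1} := by
    refine MeasurableSet.inter ?_ (measurableSet_le measurable_snd (by fun_prop))
    exact (measurable_snd hI).inter (measurableSet_le (by fun_prop) (hh.comp measurable_snd))
  have h3 : Measurable fun p : ℝ × ℝ => volume (upperLevel I h p.2 ∩ Iic p.1) :=
    measurable_measure_prodMk_left (ν := (volume : Measure ℝ)) h2
  exact Measurable.ite h1 ((h3.ennreal_toReal.pow_const j).div_const _) measurable_const

theorem levelPow_nonneg (j : ℕ) (x y : ℝ) : 0 ≤ levelPow I h j x y := by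
  unfold levelPow; split_ifs <;> positivity

theorem levelPow_eq_zero {x y : ℝ} (hxy : h x < y) (j : ℕ) : levelPow I h j x y = 0 :=
  if_neg fun hx => not_le.2 hxy hx.2

/-- A point of `I` with `h < y` bounds the superlevel set below, so its infimum `τ` lies in `I`.
Whether `τ` belongs to the set is left open, since `h` need not be right-continuous. -/
theorem upperLevel_cases (hI : I.OrdConnected) (hm : MonotoneOn h I) {y : ℝ}
    (hy : y ∈ properLevels I h) :
    upperLevel I h y = ∅ ∨
      ∃ τ ∈ I, upperLevel I h y ⊆ Ici τ ∧ I ∩ Ioi τ ⊆ upperLevel I h y := by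
  obtain ⟨x₁, hx₁, hlt⟩ := hy
  rcases (upperLevel I h y).eq_empty_or_nonempty with he | hne
  · exact Or.inl he
  have hlb : ∀ u ∈ upperLevel I h y, x₁ ≤ u := fun u hu => by
    by_contra! hc
    exact absurd (hm hu.1 hx₁ hc.le) (not_le.2 (hlt.trans_le hu.2))
  have hbdd : BddBelow (upperLevel I h y) := ⟨x₁, hlb⟩
  obtain ⟨u₀, hu₀⟩ := hne
  refine Or.inr ⟨sInf (upperLevel I h y), hI.out hx₁ hu₀.1
    ⟨le_csInf ⟨u₀, hu₀⟩ hlb, csInf_le hbdd hu₀⟩, fun u hu => csInf_le hbdd hu, ?_⟩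
  rintro u ⟨huI, hu⟩
  obtain ⟨v, hv, hvu⟩ := exists_lt_of_csInf_lt ⟨u₀, hu₀⟩ hu
  exact ⟨huI, hv.2.trans (hm hv.1 huI hvu.le)⟩

theorem levelPow_of_mem (hI : I.OrdConnected) {y τ : ℝ} (hτI : τ ∈ I)
    (hτ : upperLevel I h y ⊆ Ici τ) (hτ' : I ∩ Ioi τ ⊆ upperLevel I h y) (j : ℕ) {x : ℝ}
    (hx : x ∈ upperLevel I h y) : levelPow I h j x y = (x - τ) ^ j / (j.factorial : ℝ) := by
  have hv : volume (upperLevel I h y ∩ Iic x) = ENNReal.ofReal (x - τ) := by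
    apply le_antisymm
    · rw [← Real.volume_Icc]
      exact measure_mono fun u hu => ⟨hτ hu.1, hu.2⟩
    · rw [← Real.volume_Ioc]
      exact measure_mono fun u hu => ⟨hτ' ⟨hI.out hτI hx.1 ⟨hu.1.le, hu.2⟩, hu.1⟩, hu.2⟩
  rw [levelPow, if_pos hx, hv, ENNReal.toReal_ofReal (sub_nonneg.2 (hτ hx))]

theorem levelPow_mono (hI : I.OrdConnected) (hm : MonotoneOn h I) {y : ℝ}
    (hy : y ∈ properLevels I h) (j : ℕ) {z x : ℝ} (hz : z ∈ I) (hx : x ∈ I) (hzx : z ≤ x) :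
    levelPow I h j z y ≤ levelPow I h j x y := by
  by_cases hzU : z ∈ upperLevel I h y
  · have hxU : x ∈ upperLevel I h y := ⟨hx, hzU.2.trans (hm hz hx hzx)⟩
    rcases upperLevel_cases hI hm hy with he | ⟨τ, hτI, hτ, hτ'⟩
    · simp [he] at hzU
    rw [levelPow_of_mem hI hτI hτ hτ' j hzU, levelPow_of_mem hI hτI hτ hτ' j hxU]
    have : 0 ≤ z - τ := sub_nonneg.2 (hτ hzU)
    gcongr
  · rw [levelPow, if_neg hzU]
    exact levelPow_nonneg j x y

/-- Integrating from `τ` itself covers `x` on either side of `τ` with no boundary term. -/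
theorem integral_strictTruncPow (j : ℕ) (τ x : ℝ) :
    IntervalIntegrable (fun u => if τ < u then (u - τ) ^ j / (j.factorial : ℝ) else 0)
      volume τ x ∧
    ∫ u in τ..x, (if τ < u then (u - τ) ^ j / (j.factorial : ℝ) else 0) =
      if τ < x then (x - τ) ^ (j + 1) / ((j + 1).factorial : ℝ) else 0 := by
  rcases lt_or_ge τ x with hx | hx
  · have hc : EqOn (fun u => (u - τ) ^ j / (j.factorial : ℝ))
        (fun u => if τ < u then (u - τ) ^ j / (j.factorial : ℝ) else 0) (uIoc τ x) := by
      intro u hu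
      rw [uIoc_of_le hx.le] at hu
      simp [hu.1]
    have hi : IntervalIntegrable (fun u => (u - τ) ^ j / (j.factorial : ℝ)) volume τ x :=
      (Continuous.intervalIntegrable (by fun_prop) _ _)
    refine ⟨hi.congr hc, ?_⟩
    rw [← intervalIntegral.integral_congr_ae (ae_of_all _ fun u hu => hc hu), if_pos hx,
      intervalIntegral.integral_div,
      intervalIntegral.integral_comp_sub_right (fun u => u ^ j), integral_pow, Nat.factorial_succ]
    push_cast
    have : (j : ℝ) + 1 ≠ 0 := by positivity
    have := Nat.factorial_ne_zero j
    simp only [sub_self, ne_eq, Nat.add_eq_zero_iff, one_ne_zero, and_false, not_false_eq_true,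
      zero_pow, sub_zero]
    field_simp
  · have hc : EqOn (fun _ => (0 : ℝ))
        (fun u => if τ < u then (u - τ) ^ j / (j.factorial : ℝ) else 0) (uIoc τ x) := by
      intro u hu
      rw [uIoc_of_ge hx] at hu
      simp [not_lt.2 hu.2]
    refine ⟨(intervalIntegrable_const (c := (0 : ℝ))).congr hc, ?_⟩
    rw [← intervalIntegral.integral_congr_ae (ae_of_all _ fun u hu => hc hu)]
    simp [not_lt.2 hx]

theorem levelPow_succ (hI : I.OrdConnected) (hm : MonotoneOn h I) {y : ℝ}
    (hy : y ∈ properLevels I h) (j : ℕ) {z x : ℝ} (hz : z ∈ I) (hx : x ∈ I) :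
    IntervalIntegrable (fun u => levelPow I h j u y) volume z x ∧
      levelPow I h (j + 1) x y =
        levelPow I h (j + 1) z y + ∫ u in z..x, levelPow I h j u y := by
  rcases upperLevel_cases hI hm hy with he | ⟨τ, hτI, hτ, hτ'⟩
  · have h0 : ∀ i u, levelPow I h i u y = 0 := fun i u => if_neg (by simp [he])
    simp [h0]
  have hne : ∀ i, ∀ u ∈ I, u ≠ τ → levelPow I h i u y =
      if τ < u then (u - τ) ^ i / (i.factorial : ℝ) else 0 := by
    intro i u hu huτ
    split_ifs with hlt
    · exact levelPow_of_mem hI hτI hτ hτ' i (hτ' ⟨hu, hlt⟩)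
    · exact if_neg fun hU => huτ (le_antisymm (not_lt.1 hlt) (hτ hU))
  have heq : ∀ u ∈ I, levelPow I h (j + 1) u y =
      if τ < u then (u - τ) ^ (j + 1) / ((j + 1).factorial : ℝ) else 0 := by
    intro u hu
    rcases eq_or_ne u τ with rfl | huτ
    · by_cases hU : u ∈ upperLevel I h y
      · rw [levelPow_of_mem hI hτI hτ hτ' _ hU]; simp
      · rw [levelPow, if_neg hU]; simp
    · exact hne _ u hu huτ
  -- The strict truncated power and `levelPow` can differ only at `τ`, a null set.
  have hae : ∀ᵐ u, u ∈ uIoc z x →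
      (if τ < u then (u - τ) ^ j / (j.factorial : ℝ) else 0) = levelPow I h j u y := by
    have h1 : ∀ᵐ u : ℝ, u ≠ τ := by simp [ae_iff, measure_singleton]
    filter_upwards [h1] with u hu huzx
    exact (hne j u (hI.uIcc_subset hz hx (uIoc_subset_uIcc huzx)) hu).symm
  have hzi := integral_strictTruncPow j τ z
  have hxi := integral_strictTruncPow j τ x
  refine ⟨(hzi.1.symm.trans hxi.1).congr_ae ((ae_restrict_iff' measurableSet_uIoc).2 hae), ?_⟩
  rw [← intervalIntegral.integral_congr_ae hae, heq x hx, heq z hz, ← hzi.2, ← hxi.2,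
    intervalIntegral.integral_add_adjacent_intervals hzi.1 (hzi.1.symm.trans hxi.1)]

end LevelPow

/-! ### Layer-cake representation of the nondecreasing derivatives. -/

section Representation

open Filter Topology

/-- Each `Φ (i + 1)`, `i < n`, is an indefinite integral of `Φ i` on `I`. -/
def IntegralChain (I : Set ℝ) (Φ : ℕ → ℝ → ℝ) (n : ℕ) : Prop :=
  ∀ i < n, ∀ x ∈ I, ∀ z ∈ I, IntervalIntegrable (Φ i) volume z x ∧
    Φ (i + 1) x = Φ (i + 1) z + ∫ u in z..x, Φ i u

theorem mem_of_le_of_not_bddBelow {I : Set ℝ} (hI : I.OrdConnected) (ha : ¬ BddBelow I)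
    {x w : ℝ} (hx : x ∈ I) (hw : w ≤ x) : w ∈ I := by
  rw [not_bddBelow_iff] at ha
  obtain ⟨v, hv, hvw⟩ := ha w
  exact hI.out hv hx ⟨hvw.le, hw⟩

variable {I : Set ℝ} {Φ : ℕ → ℝ → ℝ} {n q : ℕ}

/-- A negative value of `Φ i` at `x` persists to the left of `x` by monotonicity, which would make
`Φ (i + 1)` strictly smaller at `x` than at `x - 1`. -/
theorem IntegralChain.nonneg (hΦ : IntegralChain I Φ n) (hI : I.OrdConnected)
    (ha : ¬ BddBelow I) (hq : q ≤ n) (hm : ∀ i ≤ q, MonotoneOn (Φ i) I) {i : ℕ} (hi : i < q)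
    {x : ℝ} (hx : x ∈ I) : 0 ≤ Φ i x := by
  by_contra! hneg
  have hz : x - 1 ∈ I := mem_of_le_of_not_bddBelow hI ha hx (by linarith)
  obtain ⟨hint, heq⟩ := hΦ i (hi.trans_le hq) x hx _ hz
  have h1 := hm (i + 1) hi hz hx (by linarith)
  have h2 : ∫ u in (x - 1)..x, Φ i u ≤ ∫ _ in (x - 1)..x, Φ i x := by
    refine intervalIntegral.integral_mono_on (by linarith) hint (by simp) fun u hu => ?_
    exact hm i hi.le (mem_of_le_of_not_bddBelow hI ha hx hu.2) hx hu.2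
  simp at h2
  linarith

/-- If `Φ i ≥ ε` throughout, then `Φ (i + 1)` grows by at least `d * ε = Φ (i + 1) x + ε` over `[x -
d, x]`, so it is negative at `x - d`, against `IntegralChain.nonneg`. -/
theorem IntegralChain.exists_lt (hΦ : IntegralChain I Φ n) (hI : I.OrdConnected)
    (ha : ¬ BddBelow I) (hq : q ≤ n) (hm : ∀ i ≤ q, MonotoneOn (Φ i) I) {i : ℕ}
    (hi : i + 1 < q) (hne : I.Nonempty) {ε : ℝ} (hε : 0 < ε) : ∃ x ∈ I, Φ i x < ε := by
  by_contra! hge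
  obtain ⟨x, hx⟩ := hne
  have h0 := hΦ.nonneg hI ha hq hm hi hx
  set d := Φ (i + 1) x / ε + 1 with hd
  have hdpos : 0 < d := by positivity
  have hz : x - d ∈ I := mem_of_le_of_not_bddBelow hI ha hx (by linarith)
  obtain ⟨hint, heq⟩ := hΦ i (by omega) x hx _ hz
  have h1 := hΦ.nonneg hI ha hq hm hi hz
  have h2 : ∫ _ in (x - d)..x, ε ≤ ∫ u in (x - d)..x, Φ i u := by
    refine intervalIntegral.integral_mono_on (by linarith) (by simp) hint fun u hu => ?_
    exact hge u (mem_of_le_of_not_bddBelow hI ha hx hu.2)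
  have h3 : d * ε = Φ (i + 1) x + ε := by rw [hd]; field_simp
  simp at h2
  linarith

theorem tendsto_sInf_image (hI : I.OrdConnected) (ha : ¬ BddBelow I) {g : ℝ → ℝ}
    (hg : MonotoneOn g I) (hb : BddBelow (g '' I)) {x : ℝ} (hx : x ∈ I) :
    Tendsto (fun m : ℕ => g (x - m)) atTop (𝓝 (sInf (g '' I))) := by
  have hmem : ∀ m : ℕ, x - m ∈ I := fun m =>
    mem_of_le_of_not_bddBelow hI ha hx (by have : (0 : ℝ) ≤ m := by positivity
                                           linarith)
  rw [tendsto_order]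
  refine ⟨fun a hlt => Eventually.of_forall fun m =>
    hlt.trans_le (csInf_le hb ⟨_, hmem m, rfl⟩), fun a hlt => ?_⟩
  obtain ⟨_, ⟨v, hv, rfl⟩, hva⟩ := exists_lt_of_csInf_lt (Set.Nonempty.image g ⟨x, hx⟩) hlt
  obtain ⟨N, hN⟩ := exists_nat_ge (x - v)
  filter_upwards [eventually_ge_atTop N] with m hmN
  have : (N : ℝ) ≤ m := by exact_mod_cast hmN
  exact (hg (hmem m) hv (by linarith)).trans_lt hva

variable {h : ℝ → ℝ}

theorem ofReal_integral_eq_lintegral_levelPow (hI : I.OrdConnected) (hh : Measurable h)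
    (hm : MonotoneOn h I) {i : ℕ} {A : ℝ → ℝ} (hA0 : ∀ u ∈ I, 0 ≤ A u)
    (hA : ∀ u ∈ I, ENNReal.ofReal (A u) =
      ∫⁻ y in properLevels I h, ENNReal.ofReal (levelPow I h i u y))
    {z x : ℝ} (hz : z ∈ I) (hx : x ∈ I) (hzx : z ≤ x) (hint : IntervalIntegrable A volume z x) :
    ENNReal.ofReal (∫ u in z..x, A u) = ∫⁻ y in properLevels I h,
      ENNReal.ofReal (levelPow I h (i + 1) x y - levelPow I h (i + 1) z y) := by
  have hsub : Ioc z x ⊆ I := fun u hu => hI.out hz hx ⟨hu.1.le, hu.2⟩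
  rw [intervalIntegral.integral_of_le hzx,
    ofReal_setIntegral_eq_lintegral (μ := volume.restrict (properLevels I h))
      (V := levelPow I h i) measurableSet_Ioc hint.1 (fun u hu => hA0 u (hsub hu))
      (measurable_levelPow hI.measurableSet hh i) ?_ (fun u hu => hA u (hsub hu))]
  · refine setLIntegral_congr_fun measurableSet_properLevels fun y hy => ?_
    obtain ⟨_, h2⟩ := levelPow_succ hI hm hy i hz hx
    rw [h2, intervalIntegral.integral_of_le hzx, add_sub_cancel_left]
  · filter_upwards [ae_restrict_mem measurableSet_properLevels] with y hy
    exact ⟨(levelPow_succ hI hm hy i hz hx).1.1, fun u _ => levelPow_nonneg _ _ _⟩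

/-- Here `c` is the infimum of `Φ i`, its limit at `-∞`. By `IntegralChain.exists_lt` it vanishes
below the last index, so each integration starts from an exact mixture and no polynomial terms pile
up. The lower limit of integration is sent to `-∞` by monotone convergence. -/
theorem IntegralChain.exists_lintegral_levelPow (hΦ : IntegralChain I Φ n)
    (hI : I.OrdConnected) (ha : ¬ BddBelow I) (hne : I.Nonempty) (hq : q ≤ n)
    (hm : ∀ i ≤ q, MonotoneOn (Φ i) I) (hmeas : Measurable (Φ 0)) (i : ℕ) (hi : i < q) :
    ∃ c : ℝ, 0 ≤ c ∧ (i + 1 < q → c = 0) ∧ ∀ x ∈ I, c ≤ Φ i x ∧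
      ENNReal.ofReal (Φ i x - c) =
        ∫⁻ y in properLevels I (Φ 0), ENNReal.ofReal (levelPow I (Φ 0) i x y) := by
  have hb : ∀ j < q, BddBelow (Φ j '' I) := fun j hj =>
    ⟨0, by rintro _ ⟨x, hx, rfl⟩; exact hΦ.nonneg hI ha hq hm hj hx⟩
  have hc0 : 0 ≤ sInf (Φ i '' I) := le_csInf (hne.image _)
    (by rintro _ ⟨x, hx, rfl⟩; exact hΦ.nonneg hI ha hq hm hi hx)
  refine ⟨sInf (Φ i '' I), hc0, fun hi' => ?_, fun x hx =>
    ⟨csInf_le (hb i hi) ⟨x, hx, rfl⟩, ?_⟩⟩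
  · refine le_antisymm (le_of_forall_pos_lt_add fun ε hε => ?_) hc0
    obtain ⟨x, hx, hxε⟩ := hΦ.exists_lt hI ha hq hm hi' hne hε
    rw [zero_add]
    exact (csInf_le (hb i hi) ⟨x, hx, rfl⟩).trans_lt hxε
  induction i generalizing x with
  | zero =>
    have h1 : ∀ y, ENNReal.ofReal (levelPow I (Φ 0) 0 x y) =
        (Iic (Φ 0 x)).indicator 1 y := by
      intro y
      by_cases hy : y ≤ Φ 0 x <;> simp [levelPow, upperLevel, hx, hy, indicator]
    -- A level is proper exactly when it exceeds the infimum of `Φ 0`.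
    have h2 : Iic (Φ 0 x) ∩ properLevels I (Φ 0) = Ioc (sInf (Φ 0 '' I)) (Φ 0 x) := by
      ext y
      constructor
      · rintro ⟨hyx, v, hv, hvy⟩
        exact ⟨(csInf_le (hb 0 hi) ⟨v, hv, rfl⟩).trans_lt hvy, hyx⟩
      · rintro ⟨hy, hyx⟩
        obtain ⟨_, ⟨v, hv, rfl⟩, hva⟩ := exists_lt_of_csInf_lt (hne.image _) hy
        exact ⟨hyx, v, hv, hva⟩
    simp_rw [h1]
    rw [lintegral_indicator_one measurableSet_Iic,
      Measure.restrict_apply measurableSet_Iic, h2, Real.volume_Ioc]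
  | succ i ih =>
    have hi' : i < q := by omega
    have hci : sInf (Φ i '' I) = 0 := by
      refine le_antisymm (le_of_forall_pos_lt_add fun ε hε => ?_) (le_csInf (hne.image _)
        (by rintro _ ⟨x, hx, rfl⟩; exact hΦ.nonneg hI ha hq hm hi' hx))
      obtain ⟨x, hx, hxε⟩ := hΦ.exists_lt hI ha hq hm hi hne hε
      rw [zero_add]
      exact (csInf_le (hb i hi') ⟨x, hx, rfl⟩).trans_lt hxε
    have ih' : ∀ u ∈ I, ENNReal.ofReal (Φ i u) =
        ∫⁻ y in properLevels I (Φ 0), ENNReal.ofReal (levelPow I (Φ 0) i u y) := by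
      intro u hu
      have := ih hi' (le_of_eq hci.symm) u hu
      rwa [hci, sub_zero] at this
    have hz : ∀ m : ℕ, x - m ≤ x := fun m => by
      have : (0 : ℝ) ≤ m := by positivity
      linarith
    have hzI : ∀ m : ℕ, x - m ∈ I := fun m => mem_of_le_of_not_bddBelow hI ha hx (hz m)
    have hstep : ∀ m : ℕ, ENNReal.ofReal (Φ (i + 1) x - Φ (i + 1) (x - m)) =
        ∫⁻ y in properLevels I (Φ 0), ENNReal.ofReal
          (levelPow I (Φ 0) (i + 1) x y - levelPow I (Φ 0) (i + 1) (x - m) y) := by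
      intro m
      obtain ⟨h1, h2⟩ := hΦ i (by omega) x hx _ (hzI m)
      rw [← ofReal_integral_eq_lintegral_levelPow hI hmeas (hm 0 (Nat.zero_le _))
        (fun u hu => hΦ.nonneg hI ha hq hm hi' hu) ih' (hzI m) hx (hz m) h1, h2,
        add_sub_cancel_left]
    have hlim1 : Tendsto (fun m : ℕ => ENNReal.ofReal (Φ (i + 1) x - Φ (i + 1) (x - m))) atTop
        (𝓝 (ENNReal.ofReal (Φ (i + 1) x - sInf (Φ (i + 1) '' I)))) :=
      ENNReal.tendsto_ofReal (tendsto_const_nhds.sub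
        (tendsto_sInf_image hI ha (hm _ hi.le) (hb _ hi) hx))
    refine tendsto_nhds_unique hlim1 ?_
    simp_rw [hstep]
    have hW := measurable_levelPow hI.measurableSet hmeas (i + 1)
    refine lintegral_tendsto_of_tendsto_of_monotone (fun m => ?_) ?_ ?_
    · exact ((hW.of_uncurry_left).sub (hW.of_uncurry_left)).ennreal_ofReal.aemeasurable
    · filter_upwards [ae_restrict_mem measurableSet_properLevels] with y hy m m' hmm
      refine ENNReal.ofReal_le_ofReal (sub_le_sub_left ?_ _)
      have : (m : ℝ) ≤ m' := by exact_mod_cast hmm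
      exact levelPow_mono hI (hm 0 (Nat.zero_le _)) hy _ (hzI _) (hzI _) (by linarith)
    -- For a proper level, `x - m` eventually falls outside the superlevel set, so the subtracted
    -- term becomes zero.
    · filter_upwards [ae_restrict_mem measurableSet_properLevels] with y hy
      obtain ⟨v, hv, hvy⟩ := hy
      obtain ⟨N, hN⟩ := exists_nat_ge (x - v)
      refine tendsto_const_nhds.congr' ?_
      filter_upwards [eventually_ge_atTop N] with m hmN
      have : (N : ℝ) ≤ m := by exact_mod_cast hmN
      rw [levelPow_eq_zero ((hm 0 (Nat.zero_le _) (hzI m) hv (by linarith)).trans_lt hvy),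
        sub_zero]

/-- `Φ q` itself may be unbounded below, so only its increments are represented. The limit `c` of `Φ
(q - 1)` at `-∞` contributes the linear term; for `q = 0` there is no such term and the increment is
the length of a range of levels. -/
theorem IntegralChain.exists_sub_eq_lintegral (hΦ : IntegralChain I Φ n)
    (hI : I.OrdConnected) (ha : ¬ BddBelow I) (hne : I.Nonempty) (hq : q ≤ n)
    (hm : ∀ i ≤ q, MonotoneOn (Φ i) I) (hmeas : Measurable (Φ 0)) :
    ∃ c : ℝ, 0 ≤ c ∧ (q = 0 → c = 0) ∧ ∀ x ∈ I, ∀ z ∈ I, z ≤ x →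
      0 ≤ Φ q x - Φ q z - c * (x - z) ∧
      ENNReal.ofReal (Φ q x - Φ q z - c * (x - z)) = ∫⁻ y in properLevels I (Φ 0),
        ENNReal.ofReal (levelPow I (Φ 0) q x y - levelPow I (Φ 0) q z y) := by
  rcases q with _ | i
  · refine ⟨0, le_rfl, fun _ => rfl, fun x hx z hz hzx => ?_⟩
    have hle := hm 0 le_rfl hz hx hzx
    rw [zero_mul, sub_zero]
    refine ⟨sub_nonneg.2 hle, ?_⟩
    have h1 : ∀ y, ENNReal.ofReal (levelPow I (Φ 0) 0 x y - levelPow I (Φ 0) 0 z y) =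
        (Ioc (Φ 0 z) (Φ 0 x)).indicator 1 y := by
      intro y
      by_cases hy : y ≤ Φ 0 x
      · by_cases hy' : y ≤ Φ 0 z
        · simp [levelPow, upperLevel, hx, hz, hy, hy', indicator, not_lt.2 hy']
        · simp [levelPow, upperLevel, hx, hy, hy', indicator, not_le.1 hy']
      · have hy' : ¬ y ≤ Φ 0 z := fun h' => hy (h'.trans hle)
        simp [levelPow, upperLevel, hy, hy', indicator]
    have h2 : Ioc (Φ 0 z) (Φ 0 x) ∩ properLevels I (Φ 0) = Ioc (Φ 0 z) (Φ 0 x) :=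
      inter_eq_left.2 fun y hy => ⟨z, hz, hy.1⟩
    simp_rw [h1]
    rw [lintegral_indicator_one measurableSet_Ioc,
      Measure.restrict_apply measurableSet_Ioc, h2, Real.volume_Ioc]
  · obtain ⟨c, hc0, -, hc⟩ :=
      hΦ.exists_lintegral_levelPow hI ha hne hq hm hmeas i (Nat.lt_succ_self i)
    refine ⟨c, hc0, by simp, fun x hx z hz hzx => ?_⟩
    obtain ⟨hint, heq⟩ := hΦ i hq x hx z hz
    have hint' : IntervalIntegrable (fun u => Φ i u - c) volume z x := hint.sub (by simp)
    have hval : Φ (i + 1) x - Φ (i + 1) z - c * (x - z) = ∫ u in z..x, (Φ i u - c) := by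
      rw [intervalIntegral.integral_sub hint (by simp), heq]
      simp
      ring
    rw [hval]
    refine ⟨intervalIntegral.integral_nonneg hzx fun u hu =>
      sub_nonneg.2 (hc u (hI.out hz hx hu)).1, ?_⟩
    exact ofReal_integral_eq_lintegral_levelPow hI hmeas (hm 0 (Nat.zero_le _))
      (fun u hu => sub_nonneg.2 (hc u hu).1) (fun u hu => (hc u hu).2) hz hx hzx hint'

end Representation

/-! ### Taylor remainders, their sign, and mixtures of them. -/

section Taylor

variable {I : Set ℝ} {Ψ : ℕ → ℝ → ℝ} {p : ℕ} {x₀ : ℝ}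

/-- The Taylor remainder at `x₀` of the member `Ψ i` of a chain in which `Ψ j` is the derivative
of `Ψ (j + 1)`; the subtracted Taylor polynomial has degree `i`. -/
noncomputable def taylorRem (Ψ : ℕ → ℝ → ℝ) (x₀ : ℝ) (i : ℕ) (x : ℝ) : ℝ :=
  Ψ i x - ∑ l ∈ Finset.range (i + 1), Ψ (i - l) x₀ * (x - x₀) ^ l / (l.factorial : ℝ)

theorem taylorRem_succ (hΨ : IntegralChain I Ψ p) (hx₀ : x₀ ∈ I) {i : ℕ}
    (hi : i < p) {x : ℝ} (hx : x ∈ I) :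
    IntervalIntegrable (taylorRem Ψ x₀ i) volume x₀ x ∧
      taylorRem Ψ x₀ (i + 1) x = ∫ u in x₀..x, taylorRem Ψ x₀ i u := by
  obtain ⟨hint, heq⟩ := hΨ i hi x hx x₀ hx₀
  have hpoly : ∀ l, IntervalIntegrable
      (fun u => Ψ (i - l) x₀ * (u - x₀) ^ l / (l.factorial : ℝ)) volume x₀ x :=
    fun l => Continuous.intervalIntegrable (by fun_prop) _ _
  have hsum : IntervalIntegrable (fun u => ∑ l ∈ Finset.range (i + 1),
      Ψ (i - l) x₀ * (u - x₀) ^ l / (l.factorial : ℝ)) volume x₀ x :=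
    Continuous.intervalIntegrable (by fun_prop) _ _
  refine ⟨hint.sub hsum, ?_⟩
  have hone : ∀ l, ∫ u in x₀..x, Ψ (i - l) x₀ * (u - x₀) ^ l / (l.factorial : ℝ) =
      Ψ (i - l) x₀ * (x - x₀) ^ (l + 1) / ((l + 1).factorial : ℝ) := by
    intro l
    rw [intervalIntegral.integral_div, intervalIntegral.integral_const_mul,
      intervalIntegral.integral_comp_sub_right (fun u => u ^ l), integral_pow, Nat.factorial_succ]
    push_cast
    have : (l : ℝ) + 1 ≠ 0 := by positivity
    have := Nat.factorial_ne_zero l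
    simp only [sub_self, ne_eq, Nat.add_eq_zero_iff, one_ne_zero, and_false, not_false_eq_true,
      zero_pow, sub_zero]
    field_simp
  -- The `l = 0` term is the constant `Ψ (i + 1) x₀` of the integral formula; the others are the
  -- integrated terms of the previous polynomial.
  unfold taylorRem
  rw [intervalIntegral.integral_sub hint hsum, intervalIntegral.integral_finsetSum
    fun l _ => hpoly l, Finset.sum_range_succ', heq]
  simp only [hone, Nat.add_sub_add_right]
  simp
  ring

theorem mul_intervalIntegral_eq_setIntegral_uIoc {ε x : ℝ} (hε : ε = 1 ∨ ε = -1)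
    (hx : 0 ≤ ε * (x - x₀)) (g : ℝ → ℝ) :
    ε * ∫ u in x₀..x, g u = ∫ u in uIoc x₀ x, g u := by
  rcases hε with rfl | rfl
  · rw [uIoc_of_le (by linarith), intervalIntegral.integral_of_le (by linarith), one_mul]
  · rw [uIoc_of_ge (by linarith), intervalIntegral.integral_of_ge (by linarith)]
    ring

theorem sign_mul_nonneg_of_mem_uIoc {ε x u : ℝ} (hε : ε = 1 ∨ ε = -1)
    (hx : 0 ≤ ε * (x - x₀)) (hu : u ∈ uIoc x₀ x) : 0 ≤ ε * (u - x₀) := by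
  rcases hε with rfl | rfl
  · rw [uIoc_of_le (by linarith)] at hu
    linarith [hu.1]
  · rw [uIoc_of_ge (by linarith)] at hu
    linarith [hu.2]

theorem sign_mul_taylorRem_succ (hΨ : IntegralChain I Ψ p) (hx₀ : x₀ ∈ I)
    {i : ℕ} (hi : i < p) {ε x : ℝ} (hε : ε = 1 ∨ ε = -1) (hx : x ∈ I)
    (hεx : 0 ≤ ε * (x - x₀)) :
    ε ^ (i + 2) * taylorRem Ψ x₀ (i + 1) x =
      ∫ u in uIoc x₀ x, ε ^ (i + 1) * taylorRem Ψ x₀ i u := by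
  rw [(taylorRem_succ hΨ hx₀ hi hx).2, integral_const_mul,
    ← mul_intervalIntegral_eq_setIntegral_uIoc hε hεx]
  ring

/-- The remainder of index `0` is an increment of a nondecreasing function, so it has the sign `ε`
of `x - x₀`. Each integration from `x₀` contributes another factor `ε`. -/
theorem sign_mul_taylorRem_nonneg (hI : I.OrdConnected) (hΨ : IntegralChain I Ψ p)
    (hm : MonotoneOn (Ψ 0) I) (hx₀ : x₀ ∈ I) {i : ℕ} (hi : i ≤ p) {ε x : ℝ}
    (hε : ε = 1 ∨ ε = -1) (hx : x ∈ I) (hεx : 0 ≤ ε * (x - x₀)) :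
    0 ≤ ε ^ (i + 1) * taylorRem Ψ x₀ i x := by
  induction i generalizing x with
  | zero =>
    rcases hε with rfl | rfl
    · have := hm hx₀ hx (by linarith)
      simpa [taylorRem] using this
    · have := hm hx hx₀ (by linarith)
      simpa [taylorRem] using this
  | succ i ih =>
    rw [sign_mul_taylorRem_succ hΨ hx₀ hi hε hx hεx]
    refine setIntegral_nonneg measurableSet_uIoc fun u hu => ?_
    exact ih (by omega) (hI.uIcc_subset hx₀ hx (uIoc_subset_uIcc hu))
      (sign_mul_nonneg_of_mem_uIoc hε hεx hu)

variable {μ : Measure ℝ} [SFinite μ] {V : ℕ → ℝ → ℝ → ℝ}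

theorem measurable_taylorRem (hV : ∀ i, Measurable (Function.uncurry (V i))) (x₀ : ℝ) (i : ℕ) :
    Measurable (Function.uncurry fun x y => taylorRem (fun j u => V j u y) x₀ i x) := by
  have h1 : ∀ j, Measurable fun q : ℝ × ℝ => V j x₀ q.2 := fun j =>
    (hV j).of_uncurry_left.comp measurable_snd
  refine (hV i).sub (Finset.measurable_fun_sum _ fun l _ => ?_)
  exact ((h1 _).mul ((measurable_fst.sub_const _).pow_const _)).div_const _

/-- Once multiplied by the sign, both remainders are nonnegative, so a mixture formula for the
increments of `Ψ 0` passes through each integration from `x₀` by Tonelli. -/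
theorem ofReal_sign_mul_taylorRem (hI : I.OrdConnected) (hΨ : IntegralChain I Ψ p)
    (hm : MonotoneOn (Ψ 0) I) (hx₀ : x₀ ∈ I)
    (hVm : ∀ i, Measurable (Function.uncurry (V i)))
    (hV : ∀ᵐ y ∂μ, IntegralChain I (fun j u => V j u y) p ∧ MonotoneOn (fun u => V 0 u y) I)
    (h0 : ∀ x ∈ I, ∀ z ∈ I, z ≤ x →
      ENNReal.ofReal (Ψ 0 x - Ψ 0 z) = ∫⁻ y, ENNReal.ofReal (V 0 x y - V 0 z y) ∂μ)
    {i : ℕ} (hi : i ≤ p) {ε x : ℝ}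
    (hε : ε = 1 ∨ ε = -1) (hx : x ∈ I) (hεx : 0 ≤ ε * (x - x₀)) :
    ENNReal.ofReal (ε ^ (i + 1) * taylorRem Ψ x₀ i x) =
      ∫⁻ y, ENNReal.ofReal (ε ^ (i + 1) * taylorRem (fun j u => V j u y) x₀ i x) ∂μ := by
  induction i generalizing x with
  | zero =>
    rcases hε with rfl | rfl
    · simpa [taylorRem] using h0 x hx x₀ hx₀ (by linarith)
    · simpa [taylorRem] using h0 x₀ hx₀ x hx (by linarith)
  | succ i ih =>
    have hmem : ∀ u ∈ uIoc x₀ x, u ∈ I := fun u hu =>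
      hI.uIcc_subset hx₀ hx (uIoc_subset_uIcc hu)
    rw [sign_mul_taylorRem_succ hΨ hx₀ hi hε hx hεx,
      ofReal_setIntegral_eq_lintegral (μ := μ)
        (V := fun u y => ε ^ (i + 1) * taylorRem (fun j u => V j u y) x₀ i u)
        measurableSet_uIoc ?_ ?_ ?_ ?_ ?_]
    · refine lintegral_congr_ae ?_
      filter_upwards [hV] with y hy
      rw [← sign_mul_taylorRem_succ hy.1 hx₀ hi hε hx hεx]
    · exact ((intervalIntegrable_iff.1 (taylorRem_succ hΨ hx₀ hi hx).1).const_mul _)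
    · exact fun u hu => sign_mul_taylorRem_nonneg hI hΨ hm hx₀ (by omega) hε (hmem u hu)
        (sign_mul_nonneg_of_mem_uIoc hε hεx hu)
    · exact (measurable_taylorRem hVm x₀ i).const_mul _
    · filter_upwards [hV] with y hy
      refine ⟨((intervalIntegrable_iff.1 (taylorRem_succ hy.1 hx₀ hi hx).1).const_mul _),
        fun u hu => ?_⟩
      exact sign_mul_taylorRem_nonneg hI hy.1 hy.2 hx₀ (by omega) hε (hmem u hu)
        (sign_mul_nonneg_of_mem_uIoc hε hεx hu)
    · exact fun u hu => ih (by omega) (hmem u hu) (sign_mul_nonneg_of_mem_uIoc hε hεx hu)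

theorem ofReal_taylorRem (hI : I.OrdConnected) (hΨ : IntegralChain I Ψ p)
    (hm : MonotoneOn (Ψ 0) I) (hx₀ : x₀ ∈ I)
    (hVm : ∀ i, Measurable (Function.uncurry (V i)))
    (hV : ∀ᵐ y ∂μ, IntegralChain I (fun j u => V j u y) p ∧ MonotoneOn (fun u => V 0 u y) I)
    (h0 : ∀ x ∈ I, ∀ z ∈ I, z ≤ x →
      ENNReal.ofReal (Ψ 0 x - Ψ 0 z) = ∫⁻ y, ENNReal.ofReal (V 0 x y - V 0 z y) ∂μ)
    {x : ℝ} (hx : x ∈ I) :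
    ENNReal.ofReal (taylorRem Ψ x₀ p x) =
        ∫⁻ y, ENNReal.ofReal (taylorRem (fun j u => V j u y) x₀ p x) ∂μ ∧
      ENNReal.ofReal (-taylorRem Ψ x₀ p x) =
        ∫⁻ y, ENNReal.ofReal (-taylorRem (fun j u => V j u y) x₀ p x) ∂μ := by
  obtain ⟨ε, hε, hεx⟩ : ∃ ε : ℝ, (ε = 1 ∨ ε = -1) ∧ 0 ≤ ε * (x - x₀) := by
    rcases le_total x₀ x with hle | hle
    · exact ⟨1, Or.inl rfl, by linarith⟩
    · exact ⟨-1, Or.inr rfl, by linarith⟩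
  have hmain := ofReal_sign_mul_taylorRem hI hΨ hm hx₀ hVm hV h0 le_rfl hε hx hεx
  have hΨs := sign_mul_taylorRem_nonneg hI hΨ hm hx₀ le_rfl hε hx hεx
  have hVs : ∀ᵐ y ∂μ, 0 ≤ ε ^ (p + 1) * taylorRem (fun j u => V j u y) x₀ p x := by
    filter_upwards [hV] with y hy
    exact sign_mul_taylorRem_nonneg hI hy.1 hy.2 hx₀ le_rfl hε hx hεx
  have hp : ε ^ (p + 1) = 1 ∨ ε ^ (p + 1) = -1 := by
    rcases hε with rfl | rfl
    · simp
    · exact neg_one_pow_eq_or ℝ _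
  have hzero : ∀ g : ℝ → ℝ, (∀ᵐ y ∂μ, g y ≤ 0) → ∫⁻ y, ENNReal.ofReal (g y) ∂μ = 0 := by
    intro g hg
    rw [← lintegral_zero (μ := μ)]
    refine lintegral_congr_ae ?_
    filter_upwards [hg] with y hy using ENNReal.ofReal_of_nonpos hy
  rcases hp with hp | hp <;> rw [hp] at hmain hΨs <;> simp only [hp] at hVs hmain
  · simp only [one_mul] at hmain hΨs hVs
    refine ⟨hmain, ?_⟩
    rw [ENNReal.ofReal_of_nonpos (by linarith), hzero _ (hVs.mono fun y hy => by linarith)]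
  · simp only [neg_mul, one_mul] at hmain hΨs hVs
    refine ⟨?_, hmain⟩
    rw [ENNReal.ofReal_of_nonpos (by linarith), hzero _ (hVs.mono fun y hy => by linarith)]

end Taylor

/-! ### From generalized derivatives with unit gauges to integral chains, polynomials and truncated
powers. -/

section Bridge

open Filter Topology

variable {I : Set ℝ} {w : ℕ → I → ℝ} {k n : ℕ}

theorem zeroExt_apply (g : I → ℝ) (x : I) : zeroExt g x = g x :=
  Subtype.val_injective.extend_apply _ _ _

theorem measurable_zeroExt (hI : MeasurableSet I) {g : I → ℝ} (hg : Measurable g) :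
    Measurable (zeroExt g) :=
  (MeasurableEmbedding.subtype_coe hI).measurable_extend hg measurable_const

theorem continuousWithinAt_zeroExt {g : I → ℝ} {x : I} {S : Set I} {T : Set ℝ}
    (hg : ContinuousWithinAt g S x) (hT : Subtype.val '' S ∈ 𝓝[T] (x : ℝ)) :
    ContinuousWithinAt (zeroExt g) T x := by
  have h1 : ContinuousWithinAt (zeroExt g) (Subtype.val '' S) x := by
    rw [ContinuousWithinAt, ← Topology.IsEmbedding.subtypeVal.map_nhdsWithin_eq, tendsto_map'_iff,
      zeroExt_apply]
    have : zeroExt g ∘ Subtype.val = g := funext (zeroExt_apply g)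
    rw [this]
    exact hg
  exact h1.mono_of_mem_nhdsWithin hT

/-- One-sided continuity makes `d x` the right derivative of `f` at `x`, or the left derivative when
`x` is the maximum of `I`. -/
theorem IsGaugedDeriv.unique (hI : I.OrdConnected) (ha : ¬ BddBelow I) {v f d d' : I → ℝ}
    (hv : ∀ x, v x = 1) (hd : IsGaugedDeriv v f d) (hd' : IsGaugedDeriv v f d') : d = d' := by
  have hLD : ∀ e, IsGaugedDeriv v f e → e ∈ LD I := fun e he => by
    simpa [hv] using he.2.2.1
  funext x
  by_cases hmax : IsMax x
  · have hmem : Subtype.val '' Iic x ∈ 𝓝[Iic (x : ℝ)] (x : ℝ) := by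
      refine mem_of_superset self_mem_nhdsWithin fun u hu => ?_
      exact ⟨⟨u, mem_of_le_of_not_bddBelow hI ha x.2 hu⟩, hu, rfl⟩
    have key : ∀ e, IsGaugedDeriv v f e →
        HasDerivWithinAt (zeroExt f) (e x) (Iic (x : ℝ)) x := by
      intro e he
      have hc : ContinuousWithinAt (zeroExt e) (Iic (x : ℝ)) x :=
        continuousWithinAt_zeroExt ((hLD e he x).2 hmax) hmem
      have hD := (intervalIntegral.integral_hasDerivWithinAt_right (he.2.2.2 x x).1
        (s := Iic (x : ℝ)) (t := Iic (x : ℝ))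
        (measurable_zeroExt hI.measurableSet he.2.1).stronglyMeasurable.stronglyMeasurableAtFilter
        hc).const_add (f x)
      rw [zeroExt_apply] at hD
      refine hD.congr_of_eventuallyEq ?_ (by simp [zeroExt_apply])
      filter_upwards [hmem] with u hu
      obtain ⟨u, -, rfl⟩ := hu
      rw [zeroExt_apply, (he.2.2.2 u x).2]
    exact (uniqueDiffOn_Iic (x : ℝ) x self_mem_Iic).eq_deriv _ (key d hd) (key d' hd')
  · have hmem : Subtype.val '' Ici x ∈ 𝓝[Ici (x : ℝ)] (x : ℝ) := by
      obtain ⟨b, hb⟩ := not_isMax_iff.1 hmax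
      refine mem_of_superset (Icc_mem_nhdsGE (show (x : ℝ) < b from hb)) fun u hu => ?_
      exact ⟨⟨u, hI.out x.2 b.2 hu⟩, hu.1, rfl⟩
    have key : ∀ e, IsGaugedDeriv v f e →
        HasDerivWithinAt (zeroExt f) (e x) (Ici (x : ℝ)) x := by
      intro e he
      have hc : ContinuousWithinAt (zeroExt e) (Ioi (x : ℝ)) x :=
        (continuousWithinAt_zeroExt ((hLD e he x).1 hmax) hmem).mono Ioi_subset_Ici_self
      have hD := (intervalIntegral.integral_hasDerivWithinAt_right (he.2.2.2 x x).1
        (s := Ici (x : ℝ)) (t := Ioi (x : ℝ))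
        (measurable_zeroExt hI.measurableSet he.2.1).stronglyMeasurable.stronglyMeasurableAtFilter
        hc).const_add (f x)
      rw [zeroExt_apply] at hD
      refine hD.congr_of_eventuallyEq ?_ (by simp [zeroExt_apply])
      filter_upwards [hmem] with u hu
      obtain ⟨u, -, rfl⟩ := hu
      rw [zeroExt_apply, (he.2.2.2 u x).2]
    exact (uniqueDiffOn_Ici (x : ℝ) x self_mem_Ici).eq_deriv _ (key d hd) (key d' hd')

theorem isGenDeriv_zero_iff (hw : ∀ j x, w j x = 1) {f g : I → ℝ} :
    IsGenDeriv w 0 f g ↔ Measurable f ∧ g = f := by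
  simp [IsGenDeriv, hw, funext_iff]

theorem isGenDeriv_succ_iff (hw : ∀ j x, w j x = 1) {j : ℕ} {f g : I → ℝ} :
    IsGenDeriv w (j + 1) f g ↔
      ∃ h, IsGenDeriv w j f h ∧ IsGaugedDeriv (w (j + 1)) h g := by
  constructor
  · rintro ⟨h, d, hh, hd, hg⟩
    obtain rfl : g = d := funext fun x => by rw [hg, hw, div_one]
    exact ⟨h, hh, hd⟩
  · rintro ⟨h, hh, hd⟩
    exact ⟨h, g, hh, hd, fun x => by rw [hw, div_one]⟩

theorem IsGenDeriv.unique (hI : I.OrdConnected) (ha : ¬ BddBelow I) (hw : ∀ j x, w j x = 1)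
    {j : ℕ} {f g g' : I → ℝ} (hg : IsGenDeriv w j f g) (hg' : IsGenDeriv w j f g') :
    g = g' := by
  induction j generalizing g g' with
  | zero =>
    rw [isGenDeriv_zero_iff hw] at hg hg'
    rw [hg.2, hg'.2]
  | succ j ih =>
    obtain ⟨h, hh, hd⟩ := (isGenDeriv_succ_iff hw).1 hg
    obtain ⟨h', hh', hd'⟩ := (isGenDeriv_succ_iff hw).1 hg'
    obtain rfl := ih hh hh'
    exact hd.unique hI ha (hw _) hd'

theorem IsGenDeriv.measurable (hw : ∀ j x, w j x = 1) {j : ℕ} {f g : I → ℝ}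
    (hg : IsGenDeriv w j f g) : Measurable g := by
  cases j with
  | zero =>
    rw [isGenDeriv_zero_iff hw] at hg
    rw [hg.2]
    exact hg.1
  | succ j =>
    obtain ⟨h, -, hd⟩ := (isGenDeriv_succ_iff hw).1 hg
    exact hd.2.1

theorem genDiff_antitone (hw : ∀ j x, w j x = 1) : Antitone (genDiff w) := by
  refine antitone_nat_of_succ_le fun j f hf => ?_
  obtain ⟨g, hg⟩ := hf
  obtain ⟨h, hh, -⟩ := (isGenDeriv_succ_iff hw).1 hg
  exact ⟨h, hh⟩

/-- The order is reversed: `Φ i` is `f^(n-i)`. Uniqueness is needed because `coneF` supplies a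
monotone derivative for each order separately. -/
theorem exists_integralChain (hI : I.OrdConnected) (ha : ¬ BddBelow I) (hkn : k ≤ n + 1)
    (hw : ∀ j x, w j x = 1) {f : I → ℝ} (hf : f ∈ coneF w k n) :
    ∃ Φ : ℕ → ℝ → ℝ, IntegralChain I Φ n ∧ (∀ x : I, Φ n x = f x) ∧
      (∀ i ≤ n + 1 - k, i ≤ n → MonotoneOn (Φ i) I) ∧ Measurable (Φ 0) := by
  have hex : ∀ j, ∃ g, j ≤ n → IsGenDeriv w j f g := fun j => by
    by_cases hj : j ≤ n
    · obtain ⟨g, hg⟩ := genDiff_antitone hw hj hf.1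
      exact ⟨g, fun _ => hg⟩
    · exact ⟨0, fun h => absurd h hj⟩
  choose g hg using hex
  refine ⟨fun i => zeroExt (g (n - i)), ?_, ?_, ?_, ?_⟩
  · intro i hi x hx z hz
    obtain ⟨j, rfl⟩ : ∃ j, n = i + j + 1 := ⟨n - i - 1, by omega⟩
    have e1 : i + j + 1 - i = j + 1 := by omega
    have e2 : i + j + 1 - (i + 1) = j := by omega
    simp only [e1, e2]
    obtain ⟨h, hh, hd⟩ := (isGenDeriv_succ_iff hw).1 (hg (j + 1) (by omega))
    obtain rfl := hh.unique hI ha hw (hg j (by omega))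
    have := hd.2.2.2 ⟨x, hx⟩ ⟨z, hz⟩
    rw [← zeroExt_apply (g j), ← zeroExt_apply (g j)] at this
    exact this
  · intro x
    simp only [Nat.sub_self, zeroExt_apply]
    rw [((isGenDeriv_zero_iff hw).1 (hg 0 (Nat.zero_le _))).2]
  · intro i hi hin x hx z hz hxz
    obtain ⟨g', hg', hm⟩ := hf.2 (n - i) (by omega) (by omega)
    obtain rfl := hg'.unique hI ha hw (hg (n - i) (by omega))
    have := hm (show (⟨x, hx⟩ : I) ≤ ⟨z, hz⟩ from hxz)
    rwa [← zeroExt_apply (g (n - i)), ← zeroExt_apply (g (n - i))] at this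
  · exact measurable_zeroExt hI.measurableSet ((hg (n - 0) (by omega)).measurable hw)

theorem integral_zeroExt_of_eq (hI : I.OrdConnected) {g : I → ℝ} {φ : ℝ → ℝ}
    (hg : ∀ x : I, g x = φ x) (x z : I) (hφ : IntervalIntegrable φ volume z x) :
    IntervalIntegrable (zeroExt g) volume z x ∧
      ∫ u in (z : ℝ)..x, zeroExt g u = ∫ u in (z : ℝ)..x, φ u := by
  have hc : EqOn φ (zeroExt g) (uIcc (z : ℝ) x) := fun u hu => by
    have huI := hI.uIcc_subset z.2 x.2 hu
    exact ((zeroExt_apply g ⟨u, huI⟩).trans (hg ⟨u, huI⟩)).symm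
  exact ⟨hφ.congr (hc.mono uIoc_subset_uIcc), (intervalIntegral.integral_congr hc).symm⟩

open Polynomial in
theorem isGenDeriv_polynomial (hI : I.OrdConnected) (hw : ∀ j x, w j x = 1) (P : ℝ[X]) (j : ℕ) :
    IsGenDeriv w j (fun x : I => P.eval (x : ℝ)) fun x : I => (derivative^[j] P).eval (x : ℝ) := by
  have hc : ∀ Q : ℝ[X], Continuous fun x : I => Q.eval (x : ℝ) := fun Q =>
    Q.continuous.comp continuous_subtype_val
  induction j with
  | zero => exact (isGenDeriv_zero_iff hw).2 ⟨(hc P).measurable, rfl⟩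
  | succ j ih =>
    refine (isGenDeriv_succ_iff hw).2 ⟨_, ih, (hc _).measurable, (hc _).measurable, ?_, ?_⟩
    · simp only [hw, div_one]
      exact fun x => ⟨fun _ => (hc _).continuousWithinAt, fun _ => (hc _).continuousWithinAt⟩
    · intro x z
      rw [Function.iterate_succ_apply']
      set Q := derivative^[j] P
      obtain ⟨h1, h2⟩ := integral_zeroExt_of_eq hI (g := fun x : I => Q.derivative.eval (x : ℝ))
        (φ := fun u => Q.derivative.eval u) (fun _ => rfl) x z
        (Q.derivative.continuous.intervalIntegrable _ _)
      refine ⟨h1, ?_⟩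
      rw [h2, intervalIntegral.integral_eq_sub_of_hasDerivAt (fun u _ => Q.hasDerivAt u)
        (Q.derivative.continuous.intervalIntegrable _ _)]
      ring

open Polynomial in
theorem polynomial_mem_polyCone (hI : I.OrdConnected) (hw : ∀ j x, w j x = 1) {P : ℝ[X]}
    (hP : P.natDegree ≤ n)
    (hm : ∀ j, k ≤ j + 1 → j ≤ n → Monotone fun x : ℝ => (derivative^[j] P).eval x) :
    (fun x : I => P.eval (x : ℝ)) ∈ polyCone w k n := by
  refine ⟨?_, ⟨_, isGenDeriv_polynomial hI hw P n⟩, fun j hj hjn =>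
    ⟨_, isGenDeriv_polynomial hI hw P j, fun x y hxy => hm j hj hjn hxy⟩⟩
  have := isGenDeriv_polynomial hI hw P (n + 1)
  rw [iterate_derivative_eq_zero (by omega)] at this
  simp only [eval_zero] at this
  exact this

open Polynomial in
theorem monotone_iterate_derivative_of_natDegree_le {P : ℝ[X]} {j : ℕ} (hP : P.natDegree ≤ j) :
    Monotone fun x : ℝ => (derivative^[j] P).eval x := by
  have h1 := natDegree_iterate_derivative P j
  rw [eq_C_of_natDegree_eq_zero (p := derivative^[j] P) (by omega)]
  simp [monotone_const]

open Polynomial in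
theorem polynomial_mem_polyCone_of_natDegree_lt (hI : I.OrdConnected) (hw : ∀ j x, w j x = 1)
    (hkn : k ≤ n + 1) {P : ℝ[X]} (hP : P.natDegree < k) :
    (fun x : I => P.eval (x : ℝ)) ∈ polyCone w k n :=
  polynomial_mem_polyCone hI hw (by omega) fun j hj _ =>
    monotone_iterate_derivative_of_natDegree_le (by omega)

open Polynomial in
theorem sub_pow_mem_polyCone (hI : I.OrdConnected) (hw : ∀ j x, w j x = 1)
    (hkn : k ≤ n) (z : ℝ) : (fun x : I => ((x : ℝ) - z) ^ k) ∈ polyCone w k n := by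
  have hdeg : ((X - C z) ^ k : ℝ[X]).natDegree = k := by simp
  have := polynomial_mem_polyCone (P := (X - C z) ^ k) hI hw (k := k) (hdeg.trans_le hkn) ?_
  · simpa using this
  intro j hj _
  -- Only the derivative of order `k - 1` is nonconstant here: it is an increasing affine function.
  rcases hj.eq_or_lt with hj | hj
  · rw [iterate_derivative_X_sub_pow, show k - j = 1 by omega]
    intro x y hxy
    simp only [pow_one, nsmul_eq_mul, eval_mul, eval_natCast, eval_sub, eval_X, eval_C]
    gcongr
  · exact monotone_iterate_derivative_of_natDegree_le (by omega)

theorem vanPoly_eq (hI : I.OrdConnected) (hw : ∀ j x, w j x = 1) (t : I) (d j : ℕ) (x : I) :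
    vanPoly w t d j x = ((x : ℝ) - t) ^ d / (d.factorial : ℝ) := by
  induction d generalizing j x with
  | zero => simp [vanPoly, hw]
  | succ d ih =>
    simp only [vanPoly, hw, one_mul]
    rw [(integral_zeroExt_of_eq hI
      (φ := fun u => (u - t) ^ d / (d.factorial : ℝ)) (ih (j + 1)) x t
      (Continuous.intervalIntegrable (by fun_prop) _ _)).2, intervalIntegral.integral_div,
      intervalIntegral.integral_comp_sub_right (fun u => u ^ d), integral_pow, Nat.factorial_succ]
    push_cast
    have : (d : ℝ) + 1 ≠ 0 := by positivity
    have := Nat.factorial_ne_zero d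
    simp only [sub_self, ne_eq, Nat.add_eq_zero_iff, one_ne_zero, and_false, not_false_eq_true,
      zero_pow, sub_zero]
    field_simp

theorem truncPow_eq (hI : I.OrdConnected) (hw : ∀ j x, w j x = 1) (t x : I) :
    truncPow n t x = (n.factorial : ℝ) * vanPolyPos w n t x := by
  have := Nat.factorial_ne_zero n
  unfold truncPow vanPolyPos
  split_ifs
  · rw [vanPoly_eq hI hw]
    field_simp
  · simp

theorem truncPow_nonneg (n : ℕ) (t x : ℝ) : 0 ≤ truncPow n t x := by
  unfold truncPow
  split_ifs with h
  · exact pow_nonneg (sub_nonneg.2 h) _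
  · exact le_rfl

theorem measurable_truncPow (n : ℕ) (t : ℝ) : Measurable (truncPow n t) :=
  Measurable.ite measurableSet_Ici (by fun_prop) measurable_const

end Bridge

/-! ### Arithmetic of extended integrals, and comparison on level powers. -/

section Comparison

variable {I : Set ℝ} {ν ν₁ ν₂ : Measure I} {f g : I → ℝ}

/-- `ν₂(f) ≤ ν₁(f)` with the negative parts moved to the other sides. -/
def CrossLE (ν₁ ν₂ : Measure I) (f : I → ℝ) : Prop :=
  ∫⁻ x, ENNReal.ofReal (f x) ∂ν₂ + ∫⁻ x, ENNReal.ofReal (-f x) ∂ν₁ ≤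
    ∫⁻ x, ENNReal.ofReal (f x) ∂ν₁ + ∫⁻ x, ENNReal.ofReal (-f x) ∂ν₂

/-- The integral of the negative part of `f` is finite. -/
def NegFinite (ν : Measure I) (f : I → ℝ) : Prop := ∫⁻ x, ENNReal.ofReal (-f x) ∂ν ≠ ⊤

/-- `f` is integrable with respect to both measures, with the same integral. -/
def SameIntegral (ν₁ ν₂ : Measure I) (f : I → ℝ) : Prop :=
  Integrable f ν₁ ∧ Integrable f ν₂ ∧ ∫ x, f x ∂ν₁ = ∫ x, f x ∂ν₂

theorem ereal_sub_le_sub_iff {a₁ a₂ b₁ b₂ : ENNReal} (h₁ : b₁ ≠ ⊤) (h₂ : b₂ ≠ ⊤) :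
    (a₂ : EReal) - b₂ ≤ a₁ - b₁ ↔ a₂ + b₁ ≤ a₁ + b₂ := by
  lift b₁ to NNReal using h₁
  lift b₂ to NNReal using h₂
  induction a₁ with
  | top => simp [EReal.coe_nnreal_eq_coe_real]
  | coe a₁ =>
    induction a₂ with
    | top => simp [EReal.coe_nnreal_eq_coe_real, ← EReal.coe_sub, ← ENNReal.coe_add]
    | coe a₂ =>
      simp only [EReal.coe_nnreal_eq_coe_real, ← EReal.coe_sub, ← ENNReal.coe_add,
        EReal.coe_le_coe_iff, ENNReal.coe_le_coe, ← NNReal.coe_le_coe, NNReal.coe_add]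
      constructor <;> intro h <;> linarith

theorem intGE_iff (h₁ : NegFinite ν₁ f) (h₂ : NegFinite ν₂ f) :
    IntGE ν₁ ν₂ f ↔ CrossLE ν₁ ν₂ f := by
  rw [CrossLE, ← ereal_sub_le_sub_iff h₁ h₂]
  exact ⟨fun h => h.2.2, fun h => ⟨Or.inr (lt_top_iff_ne_top.2 h₁),
    Or.inr (lt_top_iff_ne_top.2 h₂), h⟩⟩

theorem negFinite_of_bot_lt (h : ⊥ < extInt ν f) : NegFinite ν f := by
  intro htop
  rw [extInt, htop] at h
  simp at h

theorem negFinite_of_nonneg (h : ∀ x, 0 ≤ f x) : NegFinite ν f := by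
  have : ∀ x, ENNReal.ofReal (-f x) = 0 := fun x => ENNReal.ofReal_of_nonpos (by linarith [h x])
  simp [NegFinite, this]

theorem crossLE_of_nonneg_iff (h : ∀ x, 0 ≤ f x) : CrossLE ν₁ ν₂ f ↔
    ∫⁻ x, ENNReal.ofReal (f x) ∂ν₂ ≤ ∫⁻ x, ENNReal.ofReal (f x) ∂ν₁ := by
  have : ∀ x, ENNReal.ofReal (-f x) = 0 := fun x => ENNReal.ofReal_of_nonpos (by linarith [h x])
  simp [CrossLE, this]

theorem negFinite_of_integrable (h : Integrable f ν) : NegFinite ν f :=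
  (h.neg.lintegral_lt_top).ne

/-- This is `(f + g)_+ + f_- + g_- = (f + g)_- + f_+ + g_+`, arranged without subtraction so that
infinite values cause no trouble. -/
theorem lintegral_add_identity (hf : Measurable f) (hg : Measurable g) :
    ∫⁻ x, ENNReal.ofReal (f x + g x) ∂ν +
        (∫⁻ x, ENNReal.ofReal (-f x) ∂ν + ∫⁻ x, ENNReal.ofReal (-g x) ∂ν) =
      ∫⁻ x, ENNReal.ofReal (-(f x + g x)) ∂ν +
        (∫⁻ x, ENNReal.ofReal (f x) ∂ν + ∫⁻ x, ENNReal.ofReal (g x) ∂ν) := by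
  rw [← lintegral_add_left (by fun_prop), ← lintegral_add_left (by fun_prop),
    ← lintegral_add_left (by fun_prop), ← lintegral_add_left (by fun_prop)]
  refine lintegral_congr fun x => ?_
  have key : ∀ a : ℝ, ENNReal.ofReal a = ENNReal.ofReal (max a 0) := fun a => by
    rcases le_total a 0 with h | h <;> simp [h]
  rw [key (f x + g x), key (-f x), key (-g x), key (-(f x + g x)), key (f x), key (g x),
    ← ENNReal.ofReal_add, ← ENNReal.ofReal_add, ← ENNReal.ofReal_add, ← ENNReal.ofReal_add]
  · congr 1
    have h : ∀ a : ℝ, max a 0 - max (-a) 0 = a := fun a => by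
      rcases le_total a 0 with h | h <;> simp [h]
    linarith [h (f x), h (g x), h (f x + g x)]
  all_goals positivity

theorem NegFinite.add (hf : NegFinite ν f) (hg : NegFinite ν g) (hfm : Measurable f) :
    NegFinite ν fun x => f x + g x := by
  unfold NegFinite at *
  refine ne_top_of_le_ne_top (ENNReal.add_ne_top.2 ⟨hf, hg⟩) ?_
  rw [← lintegral_add_left (by fun_prop)]
  refine lintegral_mono fun x => ?_
  rw [neg_add]
  exact ENNReal.ofReal_add_le

theorem CrossLE.add (hf : CrossLE ν₁ ν₂ f) (hg : CrossLE ν₁ ν₂ g)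
    (hfm : Measurable f) (hgm : Measurable g) (hf₁ : NegFinite ν₁ f) (hf₂ : NegFinite ν₂ f)
    (hg₁ : NegFinite ν₁ g) (hg₂ : NegFinite ν₂ g) :
    CrossLE ν₁ ν₂ fun x => f x + g x := by
  have hs₁ := hf₁.add hg₁ hfm
  have hs₂ := hf₂.add hg₂ hfm
  have e₁ := lintegral_add_identity (ν := ν₁) hfm hgm
  have e₂ := lintegral_add_identity (ν := ν₂) hfm hgm
  unfold CrossLE NegFinite at *
  -- If this integral is infinite, the claim is trivial. Otherwise the identities and hypotheses
  -- make every term finite, and the claim becomes linear arithmetic over the reals.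
  by_cases htop : ∫⁻ x, ENNReal.ofReal (f x + g x) ∂ν₁ = ⊤
  · simp [htop]
  generalize ∫⁻ x, ENNReal.ofReal (f x + g x) ∂ν₁ = s₁ at *
  generalize ∫⁻ x, ENNReal.ofReal (f x + g x) ∂ν₂ = s₂ at *
  generalize ∫⁻ x, ENNReal.ofReal (-(f x + g x)) ∂ν₁ = m₁ at *
  generalize ∫⁻ x, ENNReal.ofReal (-(f x + g x)) ∂ν₂ = m₂ at *
  generalize ∫⁻ x, ENNReal.ofReal (f x) ∂ν₁ = a₁ at *
  generalize ∫⁻ x, ENNReal.ofReal (f x) ∂ν₂ = a₂ at *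
  generalize ∫⁻ x, ENNReal.ofReal (g x) ∂ν₁ = b₁ at *
  generalize ∫⁻ x, ENNReal.ofReal (g x) ∂ν₂ = b₂ at *
  generalize ∫⁻ x, ENNReal.ofReal (-f x) ∂ν₁ = c₁ at *
  generalize ∫⁻ x, ENNReal.ofReal (-f x) ∂ν₂ = c₂ at *
  generalize ∫⁻ x, ENNReal.ofReal (-g x) ∂ν₁ = d₁ at *
  generalize ∫⁻ x, ENNReal.ofReal (-g x) ∂ν₂ = d₂ at *
  have h₁ : m₁ + (a₁ + b₁) ≠ ⊤ := by
    rw [← e₁]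
    simp [htop, hf₁, hg₁]
  simp only [ne_eq, ENNReal.add_eq_top, not_or] at h₁
  have ha₂ : a₂ ≠ ⊤ := fun h => by simp [h, h₁, hf₂] at hf
  have hb₂ : b₂ ≠ ⊤ := fun h => by simp [h, h₁, hg₂] at hg
  have hs₂' : s₂ ≠ ⊤ := fun h => by
    have : m₂ + (a₂ + b₂) ≠ ⊤ := by simp [ha₂, hb₂, hs₂]
    rw [← e₂, h] at this
    simp at this
  obtain ⟨-, ha₁, hb₁⟩ := h₁
  lift s₁ to NNReal using htop
  lift s₂ to NNReal using hs₂'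
  lift m₁ to NNReal using hs₁
  lift m₂ to NNReal using hs₂
  lift a₁ to NNReal using ha₁
  lift a₂ to NNReal using ha₂
  lift b₁ to NNReal using hb₁
  lift b₂ to NNReal using hb₂
  lift c₁ to NNReal using hf₁
  lift c₂ to NNReal using hf₂
  lift d₁ to NNReal using hg₁
  lift d₂ to NNReal using hg₂
  norm_cast at *
  rw [← NNReal.coe_le_coe] at *
  rw [← NNReal.coe_inj] at e₁ e₂
  push_cast at *
  linarith

theorem CrossLE.const_mul {c : ℝ} (hc : 0 ≤ c) (hf : CrossLE ν₁ ν₂ f) (hfm : Measurable f) :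
    CrossLE ν₁ ν₂ fun x => c * f x := by
  unfold CrossLE at *
  simp_rw [← mul_neg, ENNReal.ofReal_mul hc]
  rw [lintegral_const_mul _ (by fun_prop), lintegral_const_mul _ (by fun_prop),
    lintegral_const_mul _ (by fun_prop), lintegral_const_mul _ (by fun_prop), ← mul_add, ← mul_add]
  gcongr

theorem NegFinite.const_mul {c : ℝ} (hc : 0 ≤ c) (hf : NegFinite ν f) (hfm : Measurable f) :
    NegFinite ν fun x => c * f x := by
  unfold NegFinite at *
  simp_rw [← mul_neg, ENNReal.ofReal_mul hc]
  rw [lintegral_const_mul _ (by fun_prop)]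
  exact ENNReal.mul_ne_top ENNReal.ofReal_ne_top hf

theorem integrable_of_lintegral_ne_top (hfm : Measurable f)
    (hp : ∫⁻ x, ENNReal.ofReal (f x) ∂ν ≠ ⊤) (hn : NegFinite ν f) : Integrable f ν := by
  refine ⟨hfm.aestronglyMeasurable, ?_⟩
  have h : ∀ x, ‖f x‖ₑ = ENNReal.ofReal (f x) + ENNReal.ofReal (-f x) := fun x => by
    rw [Real.enorm_eq_ofReal_abs]
    rcases le_total (f x) 0 with h | h
    · simp [abs_of_nonpos h, ENNReal.ofReal_of_nonpos h]
    · simp [abs_of_nonneg h, ENNReal.ofReal_of_nonpos (neg_nonpos.2 h)]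
  rw [HasFiniteIntegral, lintegral_congr h, lintegral_add_left (by fun_prop)]
  exact ENNReal.add_lt_top.2 ⟨lt_top_iff_ne_top.2 hp, lt_top_iff_ne_top.2 hn⟩

theorem extInt_of_integrable (hf : Integrable f ν) : extInt ν f = ((∫ x, f x ∂ν : ℝ) : EReal) := by
  rw [integral_eq_lintegral_pos_part_sub_lintegral_neg_part hf, extInt, EReal.coe_sub,
    EReal.coe_ennreal_toReal, EReal.coe_ennreal_toReal]
  · exact negFinite_of_integrable hf
  · exact hf.lintegral_lt_top.ne

theorem integrable_of_extInt_eq_coe (hfm : Measurable f) {r : ℝ} (h : extInt ν f = r) :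
    Integrable f ν := by
  have hn : NegFinite ν f := negFinite_of_bot_lt (by rw [h]; exact EReal.bot_lt_coe r)
  refine integrable_of_lintegral_ne_top hfm (fun hp => ?_) hn
  unfold NegFinite at hn
  rw [extInt, hp] at h
  lift ∫⁻ x, ENNReal.ofReal (-f x) ∂ν to NNReal using hn with b
  simp [EReal.coe_nnreal_eq_coe_real] at h

theorem intEqReal_iff (hfm : Measurable f) : IntEqReal ν₁ ν₂ f ↔ SameIntegral ν₁ ν₂ f := by
  constructor
  · rintro ⟨-, -, r, h₁, h₂⟩
    have i₁ := integrable_of_extInt_eq_coe hfm h₁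
    have i₂ := integrable_of_extInt_eq_coe hfm h₂
    refine ⟨i₁, i₂, ?_⟩
    rw [extInt_of_integrable i₁] at h₁
    rw [extInt_of_integrable i₂] at h₂
    rw [EReal.coe_eq_coe_iff.1 h₁, EReal.coe_eq_coe_iff.1 h₂]
  · rintro ⟨i₁, i₂, h⟩
    refine ⟨Or.inl i₁.lintegral_lt_top, Or.inl i₂.lintegral_lt_top, _,
      extInt_of_integrable i₁, ?_⟩
    rw [extInt_of_integrable i₂, h]

theorem SameIntegral.crossLE (h : SameIntegral ν₁ ν₂ f) : CrossLE ν₁ ν₂ f := by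
  obtain ⟨i₁, i₂, h⟩ := h
  rw [← intGE_iff (negFinite_of_integrable i₁) (negFinite_of_integrable i₂)]
  refine ⟨Or.inl i₁.lintegral_lt_top, Or.inl i₂.lintegral_lt_top, ?_⟩
  rw [extInt_of_integrable i₁, extInt_of_integrable i₂, h]

theorem sameIntegral_of_intGE (hfm : Measurable f) (h : IntGE ν₁ ν₂ f)
    (h' : IntGE ν₁ ν₂ fun x => -f x) (h₁ : NegFinite ν₁ f) (h₂ : NegFinite ν₂ f)
    (h₁' : NegFinite ν₁ fun x => -f x) (h₂' : NegFinite ν₂ fun x => -f x) :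
    SameIntegral ν₁ ν₂ f := by
  have i₁ := integrable_of_lintegral_ne_top hfm (by simpa [NegFinite] using h₁') h₁
  have i₂ := integrable_of_lintegral_ne_top hfm (by simpa [NegFinite] using h₂') h₂
  refine ⟨i₁, i₂, ?_⟩
  have e := h.2.2
  have e' := h'.2.2
  rw [extInt_of_integrable i₁, extInt_of_integrable i₂, EReal.coe_le_coe_iff] at e
  rw [extInt_of_integrable i₁.fun_neg, extInt_of_integrable i₂.fun_neg, EReal.coe_le_coe_iff,
    integral_neg, integral_neg] at e'
  linarith

theorem SameIntegral.const_mul (h : SameIntegral ν₁ ν₂ f) (c : ℝ) :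
    SameIntegral ν₁ ν₂ fun x => c * f x :=
  ⟨h.1.const_mul c, h.2.1.const_mul c, by rw [integral_const_mul, integral_const_mul, h.2.2]⟩

theorem SameIntegral.add (hf : SameIntegral ν₁ ν₂ f) (hg : SameIntegral ν₁ ν₂ g) :
    SameIntegral ν₁ ν₂ fun x => f x + g x :=
  ⟨hf.1.add hg.1, hf.2.1.add hg.2.1, by
    rw [integral_add hf.1 hg.1, integral_add hf.2.1 hg.2.1, hf.2.2, hg.2.2]⟩

theorem SameIntegral.sum {ι : Type*} {s : Finset ι} {F : ι → I → ℝ}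
    (h : ∀ i ∈ s, SameIntegral ν₁ ν₂ (F i)) :
    SameIntegral ν₁ ν₂ fun x => ∑ i ∈ s, F i x := by
  refine ⟨integrable_finsetSum _ fun i hi => (h i hi).1,
    integrable_finsetSum _ fun i hi => (h i hi).2.1, ?_⟩
  rw [integral_finsetSum _ fun i hi => (h i hi).1, integral_finsetSum _ fun i hi => (h i hi).2.1]
  exact Finset.sum_congr rfl fun i hi => (h i hi).2.2

open Polynomial in
theorem sameIntegral_polynomial {k : ℕ} {s : ℝ}
    (h : ∀ i < k, SameIntegral ν₁ ν₂ fun x : I => ((x : ℝ) - s) ^ i) {P : ℝ[X]}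
    (hP : P.natDegree < k) : SameIntegral ν₁ ν₂ fun x : I => P.eval (x : ℝ) := by
  have hev : ∀ x : I, P.eval (x : ℝ) =
      ∑ i ∈ Finset.range k, (taylor s P).coeff i * ((x : ℝ) - s) ^ i := by
    intro x
    rw [← eval_eq_sum_range' (by rwa [natDegree_taylor]), taylor_eval]
    simp
  simp_rw [hev]
  exact SameIntegral.sum fun i hi => (h i (Finset.mem_range.1 hi)).const_mul _

/-- As a function of `x`, `levelPow` is `(x - τ)_+^n / n!`, except when `n = 0` and the superlevel
set is open at `τ`. That case follows by approximating the open half-line from inside by closed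
ones. -/
theorem lintegral_levelPow_le {n : ℕ} {h : ℝ → ℝ} (hI : I.OrdConnected) (hm : MonotoneOn h I)
    (hT : ∀ t : I, ∫⁻ x : I, ENNReal.ofReal (truncPow n t x) ∂ν₂ ≤
      ∫⁻ x : I, ENNReal.ofReal (truncPow n t x) ∂ν₁)
    {y : ℝ} (hy : y ∈ properLevels I h) :
    ∫⁻ x : I, ENNReal.ofReal (levelPow I h n x y) ∂ν₂ ≤
      ∫⁻ x : I, ENNReal.ofReal (levelPow I h n x y) ∂ν₁ := by
  rcases upperLevel_cases hI hm hy with he | ⟨τ, hτI, hτ, hτ'⟩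
  · have h0 : ∀ u, levelPow I h n u y = 0 := fun u => if_neg (by simp [he])
    simp [h0]
  by_cases hcase : n ≠ 0 ∨ τ ∈ upperLevel I h y
  · have hval : ∀ x : I, levelPow I h n x y = (n.factorial : ℝ)⁻¹ * truncPow n τ x := by
      intro x
      by_cases hU : (x : ℝ) ∈ upperLevel I h y
      · rw [levelPow_of_mem hI hτI hτ hτ' n hU, truncPow, if_pos (show τ ≤ x from hτ hU)]
        ring
      · rw [levelPow, if_neg hU, truncPow]
        split_ifs with hle
        · have hx : (x : ℝ) = τ := by
            by_contra hne
            exact hU (hτ' ⟨x.2, lt_of_le_of_ne hle (Ne.symm hne)⟩)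
          have hn : n ≠ 0 := hcase.resolve_right (hx ▸ hU)
          simp [hx, hn]
        · simp
    have hc : (0 : ℝ) ≤ (n.factorial : ℝ)⁻¹ := by positivity
    have hmeas : Measurable fun x : I => ENNReal.ofReal (truncPow n τ x) :=
      ((measurable_truncPow n τ).comp measurable_subtype_coe).ennreal_ofReal
    simp_rw [hval, ENNReal.ofReal_mul hc]
    rw [lintegral_const_mul _ hmeas, lintegral_const_mul _ hmeas]
    exact mul_le_mul_right (hT ⟨τ, hτI⟩) _
  · push Not at hcase
    obtain ⟨rfl, hτU⟩ := hcase
    have hval : ∀ x : I, ENNReal.ofReal (levelPow I h 0 x y) =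
        (Ioi (⟨τ, hτI⟩ : I)).indicator 1 x := by
      intro x
      by_cases hlt : τ < x
      · have hU : (x : ℝ) ∈ upperLevel I h y := hτ' ⟨x.2, hlt⟩
        have hmem : x ∈ Ioi (⟨τ, hτI⟩ : I) := hlt
        simp [levelPow, hU, hmem]
      · have hU : (x : ℝ) ∉ upperLevel I h y := fun hU =>
          hτU ((le_antisymm (not_lt.1 hlt) (hτ hU)) ▸ hU)
        have hmem : x ∉ Ioi (⟨τ, hτI⟩ : I) := hlt
        simp [levelPow, hU, hmem]
    have hTm : ∀ t : I, ν₂ (Ici t) ≤ ν₁ (Ici t) := by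
      intro t
      have hind : ∀ x : I, ENNReal.ofReal (truncPow 0 t x) = (Ici t).indicator 1 x := fun x => by
        by_cases htx : t ≤ x
        · have : (t : ℝ) ≤ x := htx
          simp [truncPow, htx, this]
        · have : ¬ (t : ℝ) ≤ x := htx
          simp [truncPow, htx, this]
      have := hT t
      simp_rw [hind] at this
      rwa [lintegral_indicator_one measurableSet_Ici,
        lintegral_indicator_one measurableSet_Ici] at this
    simp_rw [hval]
    rw [lintegral_indicator_one measurableSet_Ioi, lintegral_indicator_one measurableSet_Ioi]
    rcases (Ioi (⟨τ, hτI⟩ : I)).eq_empty_or_nonempty with he | ⟨b, hb⟩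
    · simp [he]
    have hb' : 0 < (b : ℝ) - τ := sub_pos.2 hb
    have htI : ∀ m : ℕ, τ + (b - τ) / (m + 1) ∈ I := fun m => by
      have h1 : (b - τ) / (m + 1) ≤ b - τ := div_le_self hb'.le (by linarith [m.cast_nonneg (α := ℝ)])
      exact hI.out hτI b.2 ⟨by have : 0 ≤ (b - τ) / ((m : ℝ) + 1) := by positivity
                               linarith, by linarith⟩
    -- The left endpoints decrease to `τ` while staying in `I`, being at most `b`; continuity from
    -- below then applies even to infinite measures.
    have hun : Ioi (⟨τ, hτI⟩ : I) = ⋃ m : ℕ, Ici (⟨_, htI m⟩ : I) := by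
      ext x
      simp only [mem_Ioi, mem_iUnion, mem_Ici]
      constructor
      · intro hx
        have hx' : 0 < (x : ℝ) - τ := sub_pos.2 hx
        obtain ⟨m, hmm⟩ := exists_nat_ge ((b - τ) / (x - τ))
        refine ⟨m, ?_⟩
        change τ + (b - τ) / (m + 1) ≤ x
        rw [div_le_iff₀ hx'] at hmm
        have : (b - τ) / ((m : ℝ) + 1) ≤ x - τ := by
          rw [div_le_iff₀ (by positivity)]
          nlinarith
        linarith
      · rintro ⟨m, hmx⟩
        have hmx' : τ + (b - τ) / (m + 1) ≤ x := hmx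
        have : 0 < (b - τ) / ((m : ℝ) + 1) := by positivity
        change τ < x
        linarith
    have hmono : Monotone fun m : ℕ => Ici (⟨_, htI m⟩ : I) := by
      intro m m' hmm
      refine Ici_subset_Ici.2 ?_
      change τ + (b - τ) / (m' + 1) ≤ τ + (b - τ) / (m + 1)
      have : (m : ℝ) ≤ m' := by exact_mod_cast hmm
      gcongr
    rw [hun, hmono.measure_iUnion, hmono.measure_iUnion]
    exact iSup_mono fun m => hTm _

end Comparison

/-! ### Decomposition of a member of the cone and comparison term by term. -/

section Main

variable {I : Set ℝ} {ν ν₁ ν₂ : Measure I} {Φ : ℕ → ℝ → ℝ} {p q n k : ℕ}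

/-- Removing the linear term `c (x - x₀)` from `Φ q` removes its iterated integrals, the scaled
powers, from the later members. -/
theorem IntegralChain.shift_sub_pow (hΦ : IntegralChain I Φ n) (hpq : q + p = n) (c x₀ : ℝ) :
    IntegralChain I
      (fun i x => Φ (q + i) x - c * (x - x₀) ^ (i + 1) / ((i + 1).factorial : ℝ)) p := by
  intro i hi x hx z hz
  obtain ⟨hint, heq⟩ := hΦ (q + i) (by omega) x hx z hz
  have hpoly : IntervalIntegrable
      (fun u => c * (u - x₀) ^ (i + 1) / ((i + 1).factorial : ℝ)) volume z x :=
    Continuous.intervalIntegrable (by fun_prop) _ _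
  refine ⟨hint.sub hpoly, ?_⟩
  beta_reduce
  rw [intervalIntegral.integral_sub hint hpoly, intervalIntegral.integral_div,
    intervalIntegral.integral_const_mul,
    intervalIntegral.integral_comp_sub_right (fun u => u ^ (i + 1)), integral_pow,
    ← add_assoc q i 1, heq, Nat.factorial_succ (i + 1)]
  have : (i : ℝ) + 1 + 1 ≠ 0 := by positivity
  have := Nat.factorial_ne_zero (i + 1)
  push_cast
  field_simp
  ring

theorem integralChain_levelPow {h : ℝ → ℝ} (hI : I.OrdConnected) (hm : MonotoneOn h I) {y : ℝ}
    (hy : y ∈ properLevels I h) :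
    IntegralChain I (fun j u => levelPow I h (q + j) u y) p :=
  fun i _ _ hx _ hz => levelPow_succ hI hm hy (q + i) hz hx

theorem crossLE_of_lintegral {μ : Measure ℝ} [SFinite μ] [SFinite ν₁] [SFinite ν₂]
    {D : I → ℝ} {L : I → ℝ → ℝ} (hL : Measurable (Function.uncurry L))
    (hpos : ∀ x, ENNReal.ofReal (D x) = ∫⁻ y, ENNReal.ofReal (L x y) ∂μ)
    (hneg : ∀ x, ENNReal.ofReal (-D x) = ∫⁻ y, ENNReal.ofReal (-L x y) ∂μ)
    (hle : ∀ᵐ y ∂μ, CrossLE ν₁ ν₂ fun x => L x y) : CrossLE ν₁ ν₂ D := by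
  have hp : Measurable (Function.uncurry fun x y => ENNReal.ofReal (L x y)) := hL.ennreal_ofReal
  have hn : Measurable (Function.uncurry fun x y => ENNReal.ofReal (-L x y)) :=
    hL.neg.ennreal_ofReal
  unfold CrossLE at *
  simp_rw [hpos, hneg]
  rw [lintegral_lintegral_swap hp.aemeasurable, lintegral_lintegral_swap hp.aemeasurable,
    lintegral_lintegral_swap hn.aemeasurable, lintegral_lintegral_swap hn.aemeasurable,
    ← lintegral_add_left hp.lintegral_prod_left, ← lintegral_add_left hp.lintegral_prod_left]
  exact lintegral_mono_ae hle

theorem negFinite_of_le_add {f g D : I → ℝ} (hf : NegFinite ν f) (hg : Integrable g ν)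
    (hfm : Measurable f) (h : ∀ x, ENNReal.ofReal (-D x) ≤ ENNReal.ofReal (-f x + |g x|)) :
    NegFinite ν D := by
  unfold NegFinite at *
  refine ne_top_of_le_ne_top (ENNReal.add_ne_top.2 ⟨hf, hg.abs.lintegral_lt_top.ne⟩) ?_
  rw [← lintegral_add_left (by fun_prop)]
  exact lintegral_mono fun x => (h x).trans ENNReal.ofReal_add_le

open Polynomial in
theorem natDegree_sub_pow_sub_sub_pow_lt (hk : 1 ≤ k) (a b : ℝ) :
    ((X - C a) ^ k - (X - C b) ^ k : ℝ[X]).natDegree < k := by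
  by_cases h0 : ((X - C a) ^ k - (X - C b) ^ k : ℝ[X]) = 0
  · rw [h0, natDegree_zero]
    omega
  · rw [natDegree_lt_iff_degree_lt h0]
    have hd : ∀ c : ℝ, ((X - C c) ^ k : ℝ[X]).degree = k := fun c => by simp
    have := degree_sub_lt_left ((hd a).trans (hd b).symm) ((monic_X_sub_C a).pow k).ne_zero
      (by rw [((monic_X_sub_C a).pow k).leadingCoeff, ((monic_X_sub_C b).pow k).leadingCoeff])
    rwa [hd a] at this

open Polynomial in
-- Here `p = k - 1`, and `f` splits as `D + T + c' (x - x₀)^(p+1)`: the mixture of remainders, a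
-- Taylor polynomial of degree at most `p`, and the power carrying the limit at `-∞`.
theorem crossLE_of_integralChain (hI : I.OrdConnected) (ha : ¬ BddBelow I) (hne : I.Nonempty)
    (hpq : q + p = n) (hΦ : IntegralChain I Φ n) (hm : ∀ i ≤ q, MonotoneOn (Φ i) I)
    (hmeas : Measurable (Φ 0)) {f : I → ℝ} (hf : Measurable f) (hfΦ : ∀ x : I, f x = Φ n x)
    (hf₁ : NegFinite ν₁ f) (hf₂ : NegFinite ν₂ f) {s z : ℝ}
    (hs : ∀ i < p + 1, SameIntegral ν₁ ν₂ fun x : I => ((x : ℝ) - s) ^ i)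
    (hz : q ≠ 0 → CrossLE ν₁ ν₂ (fun x : I => ((x : ℝ) - z) ^ (p + 1)) ∧
      NegFinite ν₁ (fun x : I => ((x : ℝ) - z) ^ (p + 1)) ∧
      NegFinite ν₂ (fun x : I => ((x : ℝ) - z) ^ (p + 1)))
    (hT : ∀ t : I, ∫⁻ x : I, ENNReal.ofReal (truncPow n t x) ∂ν₂ ≤
      ∫⁻ x : I, ENNReal.ofReal (truncPow n t x) ∂ν₁) : CrossLE ν₁ ν₂ f := by
  obtain ⟨x₀, hx₀⟩ := id hne
  have hone : SameIntegral ν₁ ν₂ fun _ : I => (1 : ℝ) := by simpa using hs 0 (by omega)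
  -- The zeroth moment makes the measures finite, which supplies the s-finiteness that Tonelli
  -- requires.
  have : IsFiniteMeasure ν₁ := (integrable_const_iff_isFiniteMeasure one_ne_zero).1 hone.1
  have : IsFiniteMeasure ν₂ := (integrable_const_iff_isFiniteMeasure one_ne_zero).1 hone.2.1
  have hpow : ∀ (a : ℝ) (l : ℕ), l < p + 1 → SameIntegral ν₁ ν₂ fun x : I => ((x : ℝ) - a) ^ l :=
    fun a l hl => by
      have hX := sameIntegral_polynomial hs (P := (X - C a) ^ l) (by simpa using hl)
      have e : (fun x : I => ((X - C a) ^ l : ℝ[X]).eval (x : ℝ)) = fun x : I => ((x : ℝ) - a) ^ l := by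
        funext x
        simp
      rwa [e] at hX
  have htay : ∀ a : ℕ → ℝ, SameIntegral ν₁ ν₂ fun x : I =>
      ∑ l ∈ Finset.range (p + 1), a (p - l) * ((x : ℝ) - x₀) ^ l / (l.factorial : ℝ) := by
    intro a
    refine SameIntegral.sum fun l hl => ?_
    simpa only [mul_div_right_comm] using
      (hpow x₀ l (Finset.mem_range.1 hl)).const_mul (a (p - l) / (l.factorial : ℝ))
  obtain ⟨c, hc0, hcq, hc⟩ := hΦ.exists_sub_eq_lintegral hI ha hne (by omega) hm hmeas
  set Ψ : ℕ → ℝ → ℝ :=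
    fun i x => Φ (q + i) x - c * (x - x₀) ^ (i + 1) / ((i + 1).factorial : ℝ) with hΨdef
  have hΨ : IntegralChain I Ψ p := hΦ.shift_sub_pow hpq c x₀
  have hΨ0 : ∀ x z, Ψ 0 x - Ψ 0 z = Φ q x - Φ q z - c * (x - z) := fun x z => by
    simp [hΨdef]
    ring
  have hΨm : MonotoneOn (Ψ 0) I := fun a ha b hb hab =>
    sub_nonneg.1 ((hΨ0 b a).symm ▸ (hc b hb a ha hab).1)
  have hm0 := hm 0 (Nat.zero_le _)
  set V : ℕ → ℝ → ℝ → ℝ := fun i => levelPow I (Φ 0) (q + i) with hVdef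
  have hVm : ∀ i, Measurable (Function.uncurry (V i)) := fun i =>
    measurable_levelPow hI.measurableSet hmeas (q + i)
  set D : I → ℝ := fun x => taylorRem Ψ x₀ p x with hD
  set L : I → ℝ → ℝ := fun x y => taylorRem (fun j u => V j u y) x₀ p x with hL
  have hrep : ∀ x : I, _ := fun x => ofReal_taylorRem (μ := volume.restrict (properLevels I (Φ 0)))
    (V := V) hI hΨ hΨm hx₀ hVm
    (by
      filter_upwards [ae_restrict_mem measurableSet_properLevels] with y hy
      exact ⟨integralChain_levelPow hI hm0 hy,
        fun a ha b hb hab => levelPow_mono hI hm0 hy _ ha hb hab⟩)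
    (fun x hx z hz hzx => by rw [hΨ0]; exact (hc x hx z hz hzx).2) x.2
  have hLm : Measurable (Function.uncurry L) :=
    (measurable_taylorRem hVm x₀ p).comp
      ((measurable_subtype_coe.comp measurable_fst).prodMk measurable_snd)
  set T : I → ℝ := fun x =>
    ∑ l ∈ Finset.range (p + 1), Ψ (p - l) x₀ * ((x : ℝ) - x₀) ^ l / (l.factorial : ℝ) with hTdef
  have hTs : SameIntegral ν₁ ν₂ T := htay fun i => Ψ i x₀
  set c' : ℝ := c / ((p + 1).factorial : ℝ) with hc'
  have hc'0 : 0 ≤ c' := by positivity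
  have hfD : ∀ x, f x = D x + T x + c' * ((x : ℝ) - x₀) ^ (p + 1) := by
    intro x
    simp only [hfΦ, hD, hTdef, taylorRem, sub_add_cancel]
    simp only [hΨdef, hpq, hc']
    ring
  have hTm : Measurable T := by fun_prop
  have hDm : Measurable D := by
    have : D = fun x => f x - T x - c' * ((x : ℝ) - x₀) ^ (p + 1) := by
      funext x
      rw [hfD]
      ring
    rw [this]
    fun_prop
  have hDle : CrossLE ν₁ ν₂ D := by
    refine crossLE_of_lintegral hLm (fun x => (hrep x).1) (fun x => (hrep x).2) ?_
    filter_upwards [ae_restrict_mem measurableSet_properLevels] with y hy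
    -- For fixed `y` the remainder is a truncated power minus a polynomial of degree at most `p`,
    -- and that polynomial has equal integrals.
    have hLy : (fun x => L x y) = fun x : I => levelPow I (Φ 0) n x y + (-1) *
        ∑ l ∈ Finset.range (p + 1), V (p - l) x₀ y * ((x : ℝ) - x₀) ^ l / (l.factorial : ℝ) := by
      funext x
      simp only [hL, taylorRem, hVdef, hpq]
      ring
    have hpoly := (htay fun i => V i x₀ y).const_mul (-1)
    have hWm : Measurable fun x : I => levelPow I (Φ 0) n x y :=
      (measurable_levelPow hI.measurableSet hmeas n).of_uncurry_right.comp measurable_subtype_coe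
    have hW0 : ∀ x : I, 0 ≤ levelPow I (Φ 0) n x y := fun x => levelPow_nonneg _ _ _
    rw [hLy]
    exact CrossLE.add ((crossLE_of_nonneg_iff hW0).2 (lintegral_levelPow_le hI hm0 hT hy))
      hpoly.crossLE hWm (by fun_prop) (negFinite_of_nonneg hW0) (negFinite_of_nonneg hW0)
      (negFinite_of_integrable hpoly.1) (negFinite_of_integrable hpoly.2.1)
  -- `D` and `c' (x - x₀)^(p+1)` have the same sign. Where both are nonpositive, `-D = -f + T + c'
  -- (x - x₀)^(p+1) ≤ -f + |T|`; elsewhere the left side is zero.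
  have hDneg : ∀ x, ENNReal.ofReal (-D x) ≤ ENNReal.ofReal (-f x + |T x|) := by
    intro x
    obtain ⟨ε, hε, hεx⟩ : ∃ ε : ℝ, (ε = 1 ∨ ε = -1) ∧ 0 ≤ ε * (x - x₀) := by
      rcases le_total x₀ x with hle | hle
      · exact ⟨1, Or.inl rfl, by linarith⟩
      · exact ⟨-1, Or.inr rfl, by linarith⟩
    have hsgn := sign_mul_taylorRem_nonneg hI hΨ hΨm hx₀ le_rfl hε x.2 hεx
    have hE : 0 ≤ ε ^ (p + 1) * (c' * ((x : ℝ) - x₀) ^ (p + 1)) := by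
      have := mul_nonneg hc'0 (pow_nonneg hεx (p + 1))
      rw [mul_pow] at this
      linarith
    have hp : ε ^ (p + 1) = 1 ∨ ε ^ (p + 1) = -1 := by
      rcases hε with rfl | rfl
      · simp
      · exact neg_one_pow_eq_or ℝ _
    rcases hp with hp | hp <;> rw [hp] at hsgn hE
    · have hD0 : 0 ≤ D x := by simpa using hsgn
      rw [ENNReal.ofReal_of_nonpos (neg_nonpos.2 hD0)]
      exact zero_le
    · refine ENNReal.ofReal_le_ofReal ?_
      rw [hfD x]
      linarith [le_abs_self (T x)]
  have hD₁ := negFinite_of_le_add hf₁ hTs.1 hf hDneg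
  have hD₂ := negFinite_of_le_add hf₂ hTs.2.1 hf hDneg
  have hzm : Measurable fun x : I => ((x : ℝ) - z) ^ (p + 1) := by fun_prop
  have hcz : CrossLE ν₁ ν₂ (fun x : I => c' * ((x : ℝ) - z) ^ (p + 1)) ∧
      NegFinite ν₁ (fun x : I => c' * ((x : ℝ) - z) ^ (p + 1)) ∧
      NegFinite ν₂ (fun x : I => c' * ((x : ℝ) - z) ^ (p + 1)) := by
    by_cases hq : q = 0
    · have : c' = 0 := by rw [hc', hcq hq, zero_div]
      simp [this, CrossLE, NegFinite]
    · obtain ⟨h1, h2, h3⟩ := hz hq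
      exact ⟨h1.const_mul hc'0 hzm, h2.const_mul hc'0 hzm, h3.const_mul hc'0 hzm⟩
  -- Moving the centre of the power from `x₀` to `z` costs only a polynomial of degree at most `p`.
  have hR := sameIntegral_polynomial hs
    (natDegree_sub_pow_sub_sub_pow_lt (k := p + 1) (by omega) x₀ z)
  have hrest := hTs.add (hR.const_mul c')
  have hfsum : f = fun x => (D x + c' * ((x : ℝ) - z) ^ (p + 1)) + (T x + c' *
      ((X - C x₀) ^ (p + 1) - (X - C z) ^ (p + 1) : ℝ[X]).eval (x : ℝ)) := by
    funext x
    rw [hfD]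
    simp only [eval_sub, eval_pow, eval_X, eval_C]
    ring
  rw [hfsum]
  exact (hDle.add hcz.1 hDm (by fun_prop) hD₁ hD₂ hcz.2.1 hcz.2.2).add hrest.crossLE
    (by fun_prop) (by fun_prop) (hD₁.add hcz.2.1 hDm) (hD₂.add hcz.2.2 hDm)
    (negFinite_of_integrable hrest.1) (negFinite_of_integrable hrest.2.1)

end Main

end GMM

open Polynomial in
theorem mainTheorem4 (I : Set ℝ) (hI : I.OrdConnected) (ha : ¬ BddBelow I)
    (k n : ℕ) (hk : 1 ≤ k) (hkn : k ≤ n + 1)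
    (w : ℕ → I → ℝ) (hw : ∀ j x, w j x = 1)
    (G : Set (I → ℝ))
    (hG₁ : GMM.polyCone w k n ∪ GMM.polyPos w n ⊆ G) (hG₂ : G ⊆ GMM.coneF w k n)
    (ν₁ ν₂ : MeasureTheory.Measure I)
    (hν₁ : ν₁ ∈ GMM.admissible G) (hν₂ : ν₂ ∈ GMM.admissible G)
    (s z : ℝ) :
    (ν₁, ν₂) ∈ GMM.dualCone G ↔
      (∀ i : ℕ, i < k → GMM.IntEqReal ν₁ ν₂ (fun x : I => ((x : ℝ) - s) ^ i)) ∧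
      (k ≤ n → GMM.IntGE ν₁ ν₂ (fun x : I => ((x : ℝ) - z) ^ k)) ∧
      (∀ t : I, GMM.IntGE ν₁ ν₂ (fun x : I => GMM.truncPow n t x)) := by
  have hneg₁ : ∀ f ∈ G, GMM.NegFinite ν₁ f := fun f hf => GMM.negFinite_of_bot_lt (hν₁ f hf).2
  have hneg₂ : ∀ f ∈ G, GMM.NegFinite ν₂ f := fun f hf => GMM.negFinite_of_bot_lt (hν₂ f hf).2
  constructor
  · rintro ⟨-, -, hGE⟩
    refine ⟨fun i hi => ?_, fun hkn' => hGE _ (hG₁ (Or.inl (GMM.sub_pow_mem_polyCone hI hw hkn' z))),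
      fun t => ?_⟩
    · have hm : (fun x : I => ((x : ℝ) - s) ^ i) ∈ G := by
        have := GMM.polynomial_mem_polyCone_of_natDegree_lt hI hw hkn (P := (X - C s) ^ i)
          (by simpa using hi)
        exact hG₁ (Or.inl (by simpa using this))
      have hm' : (fun x : I => -((x : ℝ) - s) ^ i) ∈ G := by
        have := GMM.polynomial_mem_polyCone_of_natDegree_lt hI hw hkn (P := -(X - C s) ^ i)
          (by simpa using hi)
        exact hG₁ (Or.inl (by simpa using this))
      rw [GMM.intEqReal_iff (by fun_prop)]
      exact GMM.sameIntegral_of_intGE (by fun_prop) (hGE _ hm) (hGE _ hm') (hneg₁ _ hm)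
        (hneg₂ _ hm) (hneg₁ _ hm') (hneg₂ _ hm')
    -- With unit gauges this function is `(x - t)_+^n / n!`, so the comparison is rescaled by `n!`.
    · have hv : GMM.vanPolyPos w n t ∈ G := hG₁ (Or.inr ⟨t, rfl⟩)
      have hT0 : ∀ x : I, 0 ≤ GMM.truncPow n t x := fun x => GMM.truncPow_nonneg n t x
      have hc : (0 : ℝ) ≤ n.factorial := by positivity
      have hvm : Measurable (GMM.vanPolyPos w n t) := by
        have hh : GMM.vanPolyPos w n t =
            fun x : I => (n.factorial : ℝ)⁻¹ * GMM.truncPow n t x := by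
          funext x
          rw [GMM.truncPow_eq hI hw, inv_mul_cancel_left₀ (by positivity)]
        rw [hh]
        exact ((GMM.measurable_truncPow n t).comp measurable_subtype_coe).const_mul _
      rw [GMM.intGE_iff (GMM.negFinite_of_nonneg hT0) (GMM.negFinite_of_nonneg hT0)]
      simp_rw [GMM.truncPow_eq hI hw]
      exact ((GMM.intGE_iff (hneg₁ _ hv) (hneg₂ _ hv)).1 (hGE _ hv)).const_mul hc hvm
  · rintro ⟨h1, h2, h3⟩
    refine ⟨hν₁, hν₂, fun f hf => ?_⟩
    rw [GMM.intGE_iff (hneg₁ f hf) (hneg₂ f hf)]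
    obtain ⟨Φ, hΦ, hΦf, hm, hmeas⟩ := GMM.exists_integralChain hI ha hkn hw (hG₂ hf)
    obtain ⟨p, rfl⟩ : ∃ p, k = p + 1 := ⟨k - 1, by omega⟩
    have hfm : Measurable f := by
      obtain ⟨g, hg⟩ := GMM.genDiff_antitone hw (Nat.zero_le n) (hG₂ hf).1
      exact ((GMM.isGenDeriv_zero_iff hw).1 hg).1
    refine GMM.crossLE_of_integralChain (q := n - p) (s := s) (z := z) hI ha
      (Set.nonempty_iff_ne_empty.2 fun h => ha (h ▸ bddBelow_empty)) (by omega) hΦ (fun i hi => hm i (by omega) (by omega))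
      hmeas hfm (fun x => (hΦf x).symm) (hneg₁ f hf) (hneg₂ f hf)
      (fun i hi => (GMM.intEqReal_iff (by fun_prop)).1 (h1 i hi)) (fun hq => ?_) (fun t => ?_)
    · have hzG := hG₁ (Or.inl (GMM.sub_pow_mem_polyCone (k := p + 1) (n := n) hI hw (by omega) z))
      exact ⟨(GMM.intGE_iff (hneg₁ _ hzG) (hneg₂ _ hzG)).1 (h2 (by omega)), hneg₁ _ hzG,
        hneg₂ _ hzG⟩
    · have hT0 : ∀ x : I, 0 ≤ GMM.truncPow n t x := fun x => GMM.truncPow_nonneg n t x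
      exact (GMM.crossLE_of_nonneg_iff hT0).1 ((GMM.intGE_iff (GMM.negFinite_of_nonneg hT0)
        (GMM.negFinite_of_nonneg hT0)).1 (h3 t))
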